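/- Let $Q_{\sf X|U}$ be a Markov kernel from a measurable space $\mathcal U$ to a measurable space $\mathcal X$ with countably generated $\sigma$-algebra, and let $\pi_{\sf X}$ be a probability measure on $\mathcal X$. Logarithms are natural. For probability measures $P,Q$ on the same space let $\frac{dP}{dQ}\in[0,\infty]$ be the relative density (equal to $\infty$ on the part of $P$ that is singular to $Q$), and for $\gamma\ge 1$ put $$E_\gamma(P\|Q)=\mathbb P\Big[\tfrac{dP}{dQ}(X)>\gamma\Big]-\gamma\,\mathbb P\Big[\tfrac{dP}{dQ}(Y)>\gamma\Big],\qquad X\sim P,\ Y\sim Q .$$ For a codebook $c=(c_1,\dots,c_L)\in(\mathcal U^n)^L$ let $P_{{\sf X}^n(c)}=\frac1L\sum_{l=1}^L Q_{{\sf X|U}}^{\otimes n}(\cdot\,|\,c_l)$. For a probability measure $Q_{\sf U}$ on $\mathcal U$ let $Q_{\sf X}$ be the output law of the channel $Q_{\sf X|U}$ with input law $Q_{\sf U}$, let $D$ denote relative entropy, and let $I(Q_{\sf U},Q_{\sf X|U})=D(Q_{\sf U}Q_{\sf X|U}\,\|\,Q_{\sf U}\times Q_{\sf X})$; these may be $+\infty$.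 Write $[a]^+=\max(a,0)$. Let $E\ge 0$, $\gamma_n=\exp(nE)$, and let $L_n\ge1$ be integers with $\frac1n\log L_n\to R\in\mathbb R$ (that is, $L_n=\exp(n(R+o(1)))$; necessarily $R\ge0$). 1. Let $Q_{\sf U}$ be any probability measure on $\mathcal U$, let $\mathbf c=(c_1,\dots,c_{L_n})$ have i.i.d. codewords with law $Q_{\sf U}^{\otimes n}$, and let $\hat{\sf X}^n\sim P_{{\sf X}^n(\mathbf c)}$ conditionally on $\mathbf c$. (a) If $E> D(Q_{\sf X}\|\pi_{\sf X})+[I(Q_{\sf U},Q_{\sf X|U})-R]^+$, then $$\lim_{n\to\infty}\mathbb E\big[E_{\gamma_n}(P_{{\sf X}^n(\mathbf c)}\|\pi_{\sf X}^{\otimes n})\big]=\lim_{n\to\infty}\mathbb P\Big[\frac{dP_{{\sf X}^n(\mathbf c)}}{d\pi_{\sf X}^{\otimes n}}(\hat{\sf X}^n)>\gamma_n\Big]=0 .$$ (b) The threshold is tight: if $E< D(Q_{\sf X}\|\pi_{\sf X})+[I(Q_{\sf U},Q_{\sf X|U})-R]^+$, then both of these limits exist and are equal to $1$. 2. Let $r(E)=\inf\{D(Q_{\sf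 X}\|\pi_{\sf X})+I(Q_{\sf U},Q_{\sf X|U})-E:\ Q_{\sf U}\text{ with }D(Q_{\sf X}\|\pi_{\sf X})\le E\}\in[-\infty,\infty]$, with $\inf\emptyset=+\infty$. (a) Suppose that some $Q_{\sf U}$ satisfies $D(Q_{\sf X}\|\pi_{\sf X})<E$ and $I(Q_{\sf U},Q_{\sf X|U})<\infty$. If $R>r(E)$, then there are codebooks $c^{(n)}\in(\mathcal U^n)^{L_n}$ with $E_{\gamma_n}(P_{{\sf X}^n(c^{(n)})}\|\pi_{\sf X}^{\otimes n})\to0$. (b) Suppose that $\mathcal U$ and $\mathcal X$ are finite (with all subsets measurable). If there are codebooks $c^{(n)}\in(\mathcal U^n)^{L_n}$ with $E_{\gamma_n}(P_{{\sf X}^n(c^{(n)})}\|\pi_{\sf X}^{\otimes n})\to0$, then $R\ge r(E)$. -/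

import Mathlib

open MeasureTheory ProbabilityTheory InformationTheory Filter Topology
open scoped ENNReal

noncomputable section

namespace EGammaResolvability

/-- The relative density `dP/dQ` with values in `[0, ∞]`, computed through the dominating measure
`P + Q`. It is the Radon-Nikodym derivative when `P ≪ Q`, and in general equals `∞` at
`P`-almost every point of the part of `P` that is singular to `Q`. -/
def relDensity {α : Type*} [MeasurableSpace α] (P Q : Measure α) (x : α) : ℝ≥0∞ :=
  P.rnDeriv (P + Q) x / Q.rnDeriv (P + Q) x

/-- The excess information with threshold `γ`: `ℙ[dP/dQ(X) > γ]` where `X ∼ P`. -/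
def excessInfo {α : Type*} [MeasurableSpace α] (γ : ℝ≥0∞) (P Q : Measure α) : ℝ≥0∞ :=
  P {x | γ < relDensity P Q x}

/-- `E_γ(P‖Q) = ℙ[dP/dQ(X) > γ] - γ ℙ[dP/dQ(Y) > γ]` where `X ∼ P` and `Y ∼ Q`.
The first term is never smaller than the second, so the subtraction does not truncate. -/
def eGamma {α : Type*} [MeasurableSpace α] (γ : ℝ≥0∞) (P Q : Measure α) : ℝ≥0∞ :=
  P {x | γ < relDensity P Q x} - γ * Q {x | γ < relDensity P Q x}

/-- The mutual information `I(Q_U, Q_{X|U}) = D(Q_{UX} ‖ Q_U × Q_X)`, in nats. -/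
def mutualInfo {U X : Type*} [MeasurableSpace U] [MeasurableSpace X]
    (Q : Measure U) (κ : Kernel U X) : ℝ≥0∞ :=
  klDiv (Q ⊗ₘ κ) (Q.prod (κ ∘ₘ Q))

/-- The `n`-fold product `π^{⊗n}` of a measure. -/
def iidLaw {X : Type*} [MeasurableSpace X] (n : ℕ) (π : Measure X) : Measure (Fin n → X) :=
  Measure.pi fun _ => π

/-- The law of a random codebook of `L` codewords drawn independently from `Q^{⊗n}`. -/
def codebookLaw {U : Type*} [MeasurableSpace U] (L n : ℕ) (Q : Measure U) :
    Measure (Fin L → Fin n → U) :=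
  Measure.pi fun _ => iidLaw n Q

/-- The output law `P_{X^n(c)} = (1/L) ∑ l, Q_{X^n|U^n = c l}` of the memoryless channel `κ^{⊗n}`
when its input is drawn equiprobably from the codebook `c`. -/
def outputLaw {U X : Type*} [MeasurableSpace U] [MeasurableSpace X] (κ : Kernel U X)
    {L n : ℕ} (c : Fin L → Fin n → U) : Measure (Fin n → X) :=
  (L : ℝ≥0∞)⁻¹ • ∑ l, Measure.pi fun i => κ (c l i)

/-- The threshold `γ = exp(nE)`. -/
def expThreshold (E : ℝ) (n : ℕ) : ℝ≥0∞ :=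
  ENNReal.ofReal (Real.exp (n * E))

/-- `𝔼[E_γ(P_{X^n(c)} ‖ π^{⊗n})]` for the random codebook `c`. -/
def expectedEGamma {U X : Type*} [MeasurableSpace U] [MeasurableSpace X] (Q : Measure U)
    (κ : Kernel U X) (π : Measure X) (γ : ℝ≥0∞) (L n : ℕ) : ℝ≥0∞ :=
  ∫⁻ c, eGamma γ (outputLaw κ c) (iidLaw n π) ∂(codebookLaw L n Q)

/-- `ℙ[dP_{X^n(c)}/dπ^{⊗n}(X̂^n) > γ]`, where `c` is the random codebook and `X̂^n` has the
conditional law `P_{X^n(c)}` given `c`. -/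
def expectedExcessInfo {U X : Type*} [MeasurableSpace U] [MeasurableSpace X] (Q : Measure U)
    (κ : Kernel U X) (π : Measure X) (γ : ℝ≥0∞) (L n : ℕ) : ℝ≥0∞ :=
  ∫⁻ c, excessInfo γ (outputLaw κ c) (iidLaw n π) ∂(codebookLaw L n Q)

/-- Codebook sizes `L n ≥ 1` of exponential rate `R`, i.e. `L n = exp(n (R + o(1)))`. -/
def HasRate (L : ℕ → ℕ) (R : ℝ) : Prop :=
  (∀ n, 1 ≤ L n) ∧ Tendsto (fun n : ℕ => Real.log (L n) / n) atTop (𝓝 R)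

/-- The single-letter rate
`inf {D(Q_X‖π) + I(Q_U, Q_{X|U}) - E : Q_U with D(Q_X‖π) ≤ E}` (and `+∞` if there is no such
`Q_U`). -/
def singleLetterRate {U X : Type*} [MeasurableSpace U] [MeasurableSpace X]
    (κ : Kernel U X) (π : Measure X) (E : ℝ) : EReal :=
  ⨅ (Q : ProbabilityMeasure U) (_ : klDiv (κ ∘ₘ (Q : Measure U)) π ≤ ENNReal.ofReal E),
    ((klDiv (κ ∘ₘ (Q : Measure U)) π + mutualInfo (Q : Measure U) κ : ℝ≥0∞) : EReal) - (E : EReal)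

end EGammaResolvability

end

/-! By Neyman–Pearson, E_γ(P‖Q) is the maximum of P(A) - γ Q(A) over events A
(`measure_sub_mul_le_eGamma`), so a converse only needs one good event; from above, E_γ is bounded
by the excess information. The condition E > D + [I - R]^+ says that D < E and D + I < E + R, and D
+ I is the single divergence D(Q_UX‖Q_U × π) (`klDiv_compProd_prod`).

Achievability is soft covering (`lintegral_excessInfo_le`). The output law has density (1/L) ∑
F(c_l, y). Let y be the output of codeword l. If the density exceeds γ, then either the own term
F(c_l, y) exceeds γL/2, which the law of large numbers excludes when D + I < E + R, or the other
terms together reach γL/2. Those codewords are independent of y, so each term has mean the density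
of Q_X^{⊗n} at y, which is typically below exp(nb) for any b > D; Markov's inequality concludes when
D < E.

The converses rest on the Donsker–Varadhan formula (`exists_test_of_lt_klDiv`): if a < D(μ‖ν), a
bounded h has ∫ exp h dν ≤ 1 and ∫ h dμ > a. The event ∑ h ≥ na has probability at most exp(-na)
under ν^{⊗n} and tends to 1 under μ^{⊗n}. It is used on outputs if E < D, and on pairs if E + R < D
+ I, where a union over the codewords costs a factor L.

For deterministic codebooks, sufficiency mixes a good input law with a strictly feasible one and
selects a codebook no worse than the average up to a vanishing slack. Necessity uses compactness of
the simplex of input laws: finitely many tests suffice, and each codeword is detected by the test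
belonging to its type. -/

noncomputable section

namespace EGammaResolvability


/-! ### Relative densities, and E_γ as the value of an optimal test. -/

section Density

variable {α : Type*} [MeasurableSpace α]

lemma measurable_relDensity (P Q : Measure α) : Measurable (relDensity P Q) :=
  (Measure.measurable_rnDeriv _ _).div (Measure.measurable_rnDeriv _ _)

lemma measurableSet_lt_relDensity (γ : ℝ≥0∞) (P Q : Measure α) :
    MeasurableSet {x | γ < relDensity P Q x} :=
  measurableSet_lt measurable_const (measurable_relDensity P Q)

/-- Testing lower bound: no event beats the likelihood ratio test. -/
lemma measure_sub_mul_le_eGamma (P Q : Measure α) [IsFiniteMeasure P] [IsFiniteMeasure Q]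
    {γ : ℝ≥0∞} (hγ : γ ≠ ∞) {A : Set α} (hA : MeasurableSet A) :
    P A - γ * Q A ≤ eGamma γ P Q := by
  set S := {x | γ < relDensity P Q x} with hS
  have hSm : MeasurableSet S := measurableSet_lt_relDensity γ P Q
  set μ := P + Q with hμ
  have hP : P = μ.withDensity (P.rnDeriv μ) :=
    (Measure.withDensity_rnDeriv_eq P μ (Measure.AbsolutelyContinuous.rfl.add_right Q)).symm
  have hQ : Q = μ.withDensity (Q.rnDeriv μ) := by
    refine (Measure.withDensity_rnDeriv_eq Q μ ?_).symm
    rw [hμ, add_comm]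
    exact Measure.AbsolutelyContinuous.rfl.add_right P
  have hQtop := Measure.rnDeriv_ne_top Q μ
  -- The density is at most γ off `S` and exceeds γ on `S`: passing from `A` to `S` drops points of
  -- nonpositive gain and adds points of nonnegative gain.
  have h1 : P (A \ S) ≤ γ * Q (A \ S) := by
    have hm := hA.diff hSm
    calc P (A \ S) = ∫⁻ x in A \ S, P.rnDeriv μ x ∂μ := by
          conv_lhs => rw [hP]
          exact withDensity_apply _ hm
      _ ≤ ∫⁻ x in A \ S, γ * Q.rnDeriv μ x ∂μ := by
          refine setLIntegral_mono_ae' hm ?_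
          filter_upwards [hQtop] with x hx hxA
          have : P.rnDeriv μ x / Q.rnDeriv μ x ≤ γ := not_lt.1 hxA.2
          -- Where the `Q`-density vanishes the quotient is 0 or ∞, and `hγ` excludes ∞ ≤ γ.
          rcases eq_or_ne (Q.rnDeriv μ x) 0 with h0 | h0
          · by_contra hlt
            have : P.rnDeriv μ x ≠ 0 := fun h => hlt (by simp [h])
            simp [h0, ENNReal.div_zero this, hγ] at *
          · exact (ENNReal.div_le_iff h0 hx).1 this
      _ = γ * Q (A \ S) := by
          rw [lintegral_const_mul _ (Measure.measurable_rnDeriv _ _)]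
          conv_rhs => rw [hQ]
          rw [withDensity_apply _ hm]
  have h2 : γ * Q (S \ A) ≤ P (S \ A) := by
    have hm := hSm.diff hA
    calc γ * Q (S \ A) = ∫⁻ x in S \ A, γ * Q.rnDeriv μ x ∂μ := by
          rw [lintegral_const_mul _ (Measure.measurable_rnDeriv _ _)]
          conv_lhs => rw [hQ]
          rw [withDensity_apply _ hm]
      _ ≤ ∫⁻ x in S \ A, P.rnDeriv μ x ∂μ := by
          refine setLIntegral_mono_ae' hm ?_
          filter_upwards [hQtop] with x hx hxA
          have : γ < P.rnDeriv μ x / Q.rnDeriv μ x := hxA.1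
          exact ENNReal.mul_le_of_le_div this.le
      _ = P (S \ A) := by
          conv_rhs => rw [hP]
          exact (withDensity_apply _ hm).symm
  unfold eGamma
  rw [← hS]
  refine tsub_le_iff_right.2 ?_
  rw [← measure_sdiff_add_inter A hSm, ← measure_sdiff_add_inter A (μ := Q) hSm,
    ← measure_sdiff_add_inter S (μ := P) hA, ← measure_sdiff_add_inter S (μ := Q) hA,
    Set.inter_comm A S, mul_add, mul_add]
  calc P (A \ S) + P (S ∩ A) ≤ γ * Q (A \ S) + P (S ∩ A) := by gcongr
    _ ≤ _ := by
      have hx : γ * Q (S ∩ A) ≠ ∞ := ENNReal.mul_ne_top hγ (measure_ne_top _ _)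
      have hy : γ * Q (S \ A) ≠ ∞ := ENNReal.mul_ne_top hγ (measure_ne_top _ _)
      generalize γ * Q (S ∩ A) = x at *
      generalize γ * Q (S \ A) = y at *
      generalize γ * Q (A \ S) = z at *
      generalize P (S ∩ A) = u at *
      generalize P (S \ A) = v at *
      have : z + u + (y + x) ≤ v + u + (z + x) := by
        calc z + u + (y + x) ≤ z + u + (v + x) := by gcongr
          _ = v + u + (z + x) := by ring
      calc z + u = z + u + (y + x) - (y + x) :=
            (ENNReal.add_sub_cancel_right (by finiteness)).symm
        _ ≤ v + u + (z + x) - (y + x) := by gcongr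
        _ ≤ _ := by
          rw [add_comm (v + u), add_comm _ (z + x)]
          exact add_tsub_le_assoc

/-- With μ = P + Q one has dP/dμ = (dQ/dμ) F, and dQ/dμ is positive and finite `P`-almost
everywhere, so it cancels in the quotient. -/
lemma relDensity_ae_eq_of_withDensity (P Q : Measure α) [IsFiniteMeasure P] [IsFiniteMeasure Q]
    {F : α → ℝ≥0∞} (hF : Measurable F) (h : P = Q.withDensity F) :
    relDensity P Q =ᵐ[P] F := by
  set μ := P + Q with hμ
  have hQac : Q ≪ μ := by
    rw [hμ, add_comm]
    exact Measure.AbsolutelyContinuous.rfl.add_right P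
  have hPQ : P ≪ Q := by rw [h]; exact withDensity_absolutelyContinuous _ _
  have hQ : Q = μ.withDensity (Q.rnDeriv μ) := (Measure.withDensity_rnDeriv_eq Q μ hQac).symm
  have hP : P = μ.withDensity (Q.rnDeriv μ * F) := by
    rw [withDensity_mul _ (Measure.measurable_rnDeriv _ _) hF, ← hQ, h]
  have h1 : P.rnDeriv μ =ᵐ[μ] Q.rnDeriv μ * F := by
    conv_lhs => rw [hP]
    exact Measure.rnDeriv_withDensity _ ((Measure.measurable_rnDeriv _ _).mul hF)
  have hac : P ≪ μ := hPQ.trans hQac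
  filter_upwards [hac.ae_le h1, hac.ae_le (Measure.rnDeriv_ne_top Q μ),
    hPQ.ae_le (Measure.rnDeriv_pos hQac)] with x hx1 hx2 hx3
  rw [relDensity, hx1, Pi.mul_apply, mul_comm, ENNReal.mul_div_cancel_right hx3.ne' hx2]

lemma eGamma_le_excessInfo (γ : ℝ≥0∞) (P Q : Measure α) : eGamma γ P Q ≤ excessInfo γ P Q :=
  tsub_le_self

lemma excessInfo_le_one (γ : ℝ≥0∞) (P Q : Measure α) [IsProbabilityMeasure P] :
    excessInfo γ P Q ≤ 1 := prob_le_one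

lemma excessInfo_of_withDensity (P Q : Measure α) [IsFiniteMeasure P] [IsFiniteMeasure Q]
    {F : α → ℝ≥0∞} (hF : Measurable F) (h : P = Q.withDensity F) (γ : ℝ≥0∞) :
    excessInfo γ P Q = P {x | γ < F x} := by
  refine measure_congr ?_
  filter_upwards [relDensity_ae_eq_of_withDensity P Q hF h] with x hx
  exact propext (by change γ < relDensity P Q x ↔ γ < F x; rw [hx])

end Density

/-! ### Donsker–Varadhan formula and joint convexity of relative entropy. -/

section Divergence

variable {α : Type*} [MeasurableSpace α]

/-- `z = clampRatio k y` is `y` truncated to `[1/(k+1), k+1]`. -/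
def clampRatio (k : ℕ) (y : ℝ) : ℝ := max ((k + 1 : ℝ)⁻¹) (min y (k + 1))

lemma clampRatio_pos (k : ℕ) (y : ℝ) : 0 < clampRatio k y :=
  lt_max_of_lt_left (by positivity)

lemma clampRatio_le (k : ℕ) (y : ℝ) : clampRatio k y ≤ k + 1 := by
  refine max_le ?_ (min_le_right _ _)
  have : (0:ℝ) ≤ k := k.cast_nonneg
  exact (inv_le_one_of_one_le₀ (by linarith)).trans (by linarith)

lemma abs_log_clampRatio_le (k : ℕ) (y : ℝ) : |Real.log (clampRatio k y)| ≤ Real.log (k + 1) := by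
  rw [abs_le]
  constructor
  · rw [← Real.log_inv]
    exact Real.log_le_log (by positivity) (le_max_left _ _)
  · exact Real.log_le_log (clampRatio_pos k y) (clampRatio_le k y)

lemma measurable_clampRatio (k : ℕ) : Measurable (clampRatio k) :=
  measurable_const.max (measurable_id.min measurable_const)

/-- Clamping moves `y` toward 1, so `y - z` and `log z` never have opposite signs; hence y log z ≥ z
log z ≥ z - 1. The sign is needed to turn a lower integral of truncations back into a Bochner
integral. -/
lemma clampRatio_fenchel_nonneg (k : ℕ) (y : ℝ) :
    0 ≤ y * Real.log (clampRatio k y) + 1 - clampRatio k y := by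
  set z := clampRatio k y with hz
  have hzpos : 0 < z := clampRatio_pos k y
  have h0 : z - 1 ≤ z * Real.log z := by
    have := Real.one_sub_inv_le_log_of_pos hzpos
    have h := mul_le_mul_of_nonneg_left this hzpos.le
    rwa [mul_sub, mul_inv_cancel₀ hzpos.ne', mul_one] at h
  have hk : (0:ℝ) ≤ k := k.cast_nonneg
  have hk1 : ((k:ℝ) + 1)⁻¹ ≤ 1 := inv_le_one_of_one_le₀ (by linarith)
  have hmono : z * Real.log z ≤ y * Real.log z := by
    rcases le_total 1 z with h | h
    · rcases h.eq_or_lt with h | h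
      · simp [← h]
      · refine mul_le_mul_of_nonneg_right ?_ (Real.log_nonneg h.le)
        rw [hz, clampRatio] at h ⊢
        rcases lt_max_iff.1 h with h' | h'
        · linarith
        · exact max_le (hk1.trans (h'.le.trans (min_le_left _ _))) (min_le_left _ _)
    · rcases h.eq_or_lt with h | h
      · simp [h]
      · refine mul_le_mul_of_nonpos_right ?_ (Real.log_nonpos hzpos.le h.le)
        rw [hz, clampRatio] at h ⊢
        refine le_max_of_le_right (le_min le_rfl ?_)
        have h2 := (max_lt_iff.1 h).2
        rcases min_lt_iff.1 h2 with h' | h' <;> linarith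
  linarith

lemma tendsto_clampRatio_fenchel {y : ℝ} (hy : 0 ≤ y) :
    Tendsto (fun k => y * Real.log (clampRatio k y) + 1 - clampRatio k y) atTop
      (𝓝 (klFun y)) := by
  have hz : Tendsto (fun k => clampRatio k y) atTop (𝓝 y) := by
    have h1 : Tendsto (fun k : ℕ => ((k : ℝ) + 1)⁻¹) atTop (𝓝 0) :=
      tendsto_inv_atTop_zero.comp (tendsto_natCast_atTop_atTop.atTop_add tendsto_const_nhds)
    have h2 : Tendsto (fun k : ℕ => min y ((k : ℝ) + 1)) atTop (𝓝 y) := by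
      refine tendsto_const_nhds.congr' ?_
      filter_upwards [eventually_ge_atTop ⌈y⌉₊] with k hk
      have := Nat.ceil_le.1 hk
      rw [min_eq_left (by linarith)]
    have := h1.max h2
    rwa [max_eq_right hy] at this
  rw [klFun_apply]
  refine Tendsto.sub (Tendsto.add_const _ ?_) hz
  rcases hy.eq_or_lt with rfl | hy
  · simp
  · exact (hz.log hy.ne').const_mul y

/-- Fenchel–Young: exp t - 1 is the conjugate of `klFun`. It reduces to s + 1 ≤ exp s at s = t - log
y. -/
lemma fenchel_young_klFun {y : ℝ} (hy : 0 ≤ y) (t : ℝ) :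
    y * t ≤ klFun y + Real.exp t - 1 := by
  rw [klFun_apply]
  rcases hy.eq_or_lt with rfl | hy
  · simp [Real.exp_nonneg]
  · have h := mul_le_mul_of_nonneg_left (Real.add_one_le_exp (t - Real.log y)) hy.le
    rw [Real.exp_sub, Real.exp_log hy, mul_div_cancel₀ _ hy.ne'] at h
    linarith

lemma integrable_of_abs_le {μ : Measure α} [IsFiniteMeasure μ] {h : α → ℝ} (hm : Measurable h)
    {M : ℝ} (hM : ∀ x, |h x| ≤ M) : Integrable h μ :=
  Integrable.of_bound hm.aestronglyMeasurable M (ae_of_all _ hM)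

lemma integrable_exp_of_abs_le {μ : Measure α} [IsFiniteMeasure μ] {h : α → ℝ}
    (hm : Measurable h) {M : ℝ} (hM : ∀ x, |h x| ≤ M) :
    Integrable (fun x => Real.exp (h x)) μ := by
  refine integrable_of_abs_le hm.exp (M := Real.exp M) fun x => ?_
  rw [abs_of_pos (Real.exp_pos _)]
  exact Real.exp_le_exp.2 ((le_abs_self _).trans (hM x))

/-- The easy half of the Donsker-Varadhan formula, in linearised form. -/
lemma integral_le_klDiv_add (μ ν : Measure α) [IsProbabilityMeasure μ] [IsProbabilityMeasure ν]
    (hfin : klDiv μ ν ≠ ∞) {h : α → ℝ} (hm : Measurable h) {M : ℝ} (hM : ∀ x, |h x| ≤ M) :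
    ∫ x, h x ∂μ ≤ (klDiv μ ν).toReal + ∫ x, Real.exp (h x) ∂ν - 1 := by
  obtain ⟨hac, hint⟩ := klDiv_ne_top_iff.1 hfin
  have h1 : Integrable (fun x => klFun (μ.rnDeriv ν x).toReal) ν :=
    (integrable_klFun_rnDeriv_iff hac).2 hint
  have h2 := integrable_exp_of_abs_le (μ := ν) hm hM
  have h3 : Integrable (fun x => (μ.rnDeriv ν x).toReal * h x) ν :=
    (integrable_rnDeriv_smul_iff (f := h) hac).2 (integrable_of_abs_le hm hM)
  have h4 : ∫ x, (μ.rnDeriv ν x).toReal * h x ∂ν = ∫ x, h x ∂μ :=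
    integral_rnDeriv_smul (f := h) hac
  rw [← h4, toReal_klDiv_eq_integral_klFun hac]
  calc _ ≤ ∫ x, (klFun (μ.rnDeriv ν x).toReal + Real.exp (h x) - 1) ∂ν :=
        integral_mono h3 ((h1.add h2).sub (integrable_const _)) fun x =>
          fenchel_young_klFun ENNReal.toReal_nonneg _
    _ = _ := by
        have e : ∫ x, (klFun (μ.rnDeriv ν x).toReal + Real.exp (h x) - 1) ∂ν
            = ∫ x, (klFun (μ.rnDeriv ν x).toReal + Real.exp (h x)) ∂ν - ∫ _, (1 : ℝ) ∂ν :=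
          integral_sub (h1.add h2) (integrable_const _)
        rw [e, integral_add h1 h2]
        simp

/-- The hard half of the Donsker-Varadhan formula: every number below the divergence is beaten by
a bounded, exponentially normalised test function. -/
lemma exists_test_of_lt_klDiv (μ ν : Measure α) [IsProbabilityMeasure μ] [IsProbabilityMeasure ν]
    {a : ℝ} (ha : ENNReal.ofReal a < klDiv μ ν) :
    ∃ (h : α → ℝ) (M : ℝ), Measurable h ∧ (∀ x, |h x| ≤ M) ∧
      ∫ x, Real.exp (h x) ∂ν ≤ 1 ∧ a < ∫ x, h x ∂μ := by
  by_cases hac : μ ≪ ν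
  · rw [klDiv_eq_lintegral_klFun_of_ac hac] at ha
    set y : α → ℝ := fun x => (μ.rnDeriv ν x).toReal with hy
    have hym : Measurable y := (Measure.measurable_rnDeriv μ ν).ennreal_toReal
    have hy0 : ∀ x, 0 ≤ y x := fun x => ENNReal.toReal_nonneg
    have hzm : ∀ k, Measurable fun x => clampRatio k (y x) := fun k =>
      (measurable_clampRatio k).comp hym
    set φ : ℕ → α → ℝ := fun k x =>
      y x * Real.log (clampRatio k (y x)) + 1 - clampRatio k (y x) with hφ
    have hφm : ∀ k, Measurable (φ k) := fun k =>
      ((hym.mul (hzm k).log).add_const _).sub (hzm k)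
    -- Fatou's lemma: the truncated integrands converge to `klFun`, so some finite level `k` already
    -- beats `a`.
    have hF : ∫⁻ x, ENNReal.ofReal (klFun (y x)) ∂ν
        ≤ liminf (fun k => ∫⁻ x, ENNReal.ofReal (φ k x) ∂ν) atTop := by
      refine le_trans (lintegral_mono fun x => ?_)
        (lintegral_liminf_le fun k => (hφm k).ennreal_ofReal)
      exact ((ENNReal.continuous_ofReal.tendsto _).comp
        (tendsto_clampRatio_fenchel (hy0 x))).liminf_eq.ge
    obtain ⟨k, hk⟩ := (eventually_lt_of_lt_liminf (ha.trans_le hF)).exists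
    have hlogm : Measurable fun x => Real.log (clampRatio k (y x)) := (hzm k).log
    have hlogb : ∀ x, |Real.log (clampRatio k (y x))| ≤ Real.log (k + 1) := fun x =>
      abs_log_clampRatio_le k (y x)
    have hzi : Integrable (fun x => clampRatio k (y x)) ν :=
      integrable_of_abs_le (hzm k) fun x => by
        rw [abs_of_pos (clampRatio_pos _ _)]
        exact clampRatio_le k (y x)
    have hi1 : Integrable (fun x => y x * Real.log (clampRatio k (y x))) ν :=
      (integrable_rnDeriv_smul_iff (f := fun x => Real.log (clampRatio k (y x))) hac).2
        (integrable_of_abs_le hlogm hlogb)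
    have hi2 : ∫ x, y x * Real.log (clampRatio k (y x)) ∂ν
        = ∫ x, Real.log (clampRatio k (y x)) ∂μ :=
      integral_rnDeriv_smul (f := fun x => Real.log (clampRatio k (y x))) hac
    have hφk : Integrable (φ k) ν := (hi1.add (integrable_const 1)).sub hzi
    rw [← ofReal_integral_eq_lintegral_ofReal hφk
      (ae_of_all _ fun x => clampRatio_fenchel_nonneg k (y x))] at hk
    have hk' : a < ∫ x, φ k x ∂ν := (ENNReal.ofReal_lt_ofReal_iff'.1 hk).1
    have hφi : ∫ x, φ k x ∂ν = ∫ x, Real.log (clampRatio k (y x)) ∂μ + 1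
        - ∫ x, clampRatio k (y x) ∂ν := by
      have e : ∫ x, φ k x ∂ν = ∫ x, (y x * Real.log (clampRatio k (y x)) + 1) ∂ν
          - ∫ x, clampRatio k (y x) ∂ν := integral_sub (hi1.add (integrable_const 1)) hzi
      rw [e, integral_add hi1 (integrable_const 1), hi2]
      simp
    -- The test is `log z` recentred by `log Z`, so its exponential has integral 1. The cost log Z ≤
    -- Z - 1 is already deducted in `φ k`.
    set Z := ∫ x, clampRatio k (y x) ∂ν with hZ
    have hZpos : 0 < Z := by
      refine lt_of_lt_of_le (b := ((k : ℝ) + 1)⁻¹) (by positivity) ?_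
      have := integral_mono (μ := ν) (integrable_const ((k : ℝ) + 1)⁻¹) hzi
        fun x => le_max_left _ _
      simpa using this
    refine ⟨fun x => Real.log (clampRatio k (y x)) - Real.log Z, Real.log (k + 1) + |Real.log Z|,
      hlogm.sub_const _, fun x => (abs_sub _ _).trans (by gcongr; exact hlogb x), ?_, ?_⟩
    · simp_rw [Real.exp_sub, Real.exp_log hZpos, Real.exp_log (clampRatio_pos _ _)]
      rw [integral_div, ← hZ, div_self hZpos.ne']
    · rw [integral_sub (integrable_of_abs_le hlogm hlogb) (integrable_const _)]
      have := Real.log_le_sub_one_of_pos hZpos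
      simp only [integral_const, probReal_univ, smul_eq_mul, one_mul]
      linarith
  -- Without absolute continuity, a `ν`-null set `B` carries `μ`-mass: a multiple of its indicator
  -- is invisible to `ν` and can be given `μ`-mean |a| + 1.
  · obtain ⟨B, hBm, hB0, hB⟩ : ∃ B, MeasurableSet B ∧ ν B = 0 ∧ μ B ≠ 0 := by
      by_contra! hcon
      exact hac (Measure.AbsolutelyContinuous.mk fun s hs h0 => hcon s hs h0)
    have hpos : 0 < μ.real B := ENNReal.toReal_pos hB (measure_ne_top _ _)
    set c : ℝ := (|a| + 1) / μ.real B with hc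
    have hc0 : 0 ≤ c := by positivity
    refine ⟨B.indicator fun _ => c, c, measurable_const.indicator hBm, fun x => ?_, ?_, ?_⟩
    · by_cases hx : x ∈ B <;> simp [hx, abs_of_nonneg hc0, hc0]
    · have : (fun x => Real.exp (B.indicator (fun _ => c) x)) =ᵐ[ν] fun _ => 1 := by
        filter_upwards [measure_eq_zero_iff_ae_notMem.1 hB0] with x hx
        simp [hx]
      rw [integral_congr_ae this]
      simp
    · rw [integral_indicator_const _ hBm, smul_eq_mul, hc, mul_div_cancel₀ _ hpos.ne']
      linarith [le_abs_self a]

lemma klDiv_le_of_forall_test (μ ν : Measure α) [IsProbabilityMeasure μ] [IsProbabilityMeasure ν]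
    {b : ℝ} (H : ∀ (h : α → ℝ) (M : ℝ), Measurable h → (∀ x, |h x| ≤ M) →
      ∫ x, Real.exp (h x) ∂ν ≤ 1 → ∫ x, h x ∂μ ≤ b) : klDiv μ ν ≤ ENNReal.ofReal b := by
  by_contra! hlt
  obtain ⟨h, M, hm, hM, h1, h2⟩ := exists_test_of_lt_klDiv μ ν hlt
  exact absurd (H h M hm hM h1) (not_le.2 h2)

lemma integral_mix {μ₀ μ₁ : Measure α} {s t : ℝ} (hs : 0 ≤ s) (ht : 0 ≤ t) {h : α → ℝ}
    (h₀ : Integrable h μ₀) (h₁ : Integrable h μ₁) :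
    ∫ x, h x ∂(ENNReal.ofReal s • μ₀ + ENNReal.ofReal t • μ₁)
      = s * ∫ x, h x ∂μ₀ + t * ∫ x, h x ∂μ₁ := by
  rw [integral_add_measure (h₀.smul_measure ENNReal.ofReal_ne_top)
    (h₁.smul_measure ENNReal.ofReal_ne_top), integral_smul_measure, integral_smul_measure,
    ENNReal.toReal_ofReal hs, ENNReal.toReal_ofReal ht, smul_eq_mul, smul_eq_mul]

lemma isProbabilityMeasure_mix (μ₀ μ₁ : Measure α) [IsProbabilityMeasure μ₀]
    [IsProbabilityMeasure μ₁] {s t : ℝ} (hs : 0 ≤ s) (ht : 0 ≤ t) (hst : s + t = 1) :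
    IsProbabilityMeasure (ENNReal.ofReal s • μ₀ + ENNReal.ofReal t • μ₁) := by
  constructor
  simp [← ENNReal.ofReal_add hs ht, hst]

/-- Joint convexity of the relative entropy. -/
lemma klDiv_mix_le (μ₀ μ₁ ν₀ ν₁ : Measure α) [IsProbabilityMeasure μ₀] [IsProbabilityMeasure μ₁]
    [IsProbabilityMeasure ν₀] [IsProbabilityMeasure ν₁] {s t : ℝ} (hs : 0 ≤ s) (ht : 0 ≤ t)
    (hst : s + t = 1) (h₀ : klDiv μ₀ ν₀ ≠ ∞) (h₁ : klDiv μ₁ ν₁ ≠ ∞) :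
    klDiv (ENNReal.ofReal s • μ₀ + ENNReal.ofReal t • μ₁)
        (ENNReal.ofReal s • ν₀ + ENNReal.ofReal t • ν₁)
      ≤ ENNReal.ofReal (s * (klDiv μ₀ ν₀).toReal + t * (klDiv μ₁ ν₁).toReal) := by
  have := isProbabilityMeasure_mix μ₀ μ₁ hs ht hst
  have := isProbabilityMeasure_mix ν₀ ν₁ hs ht hst
  refine klDiv_le_of_forall_test _ _ fun h M hm hM h1 => ?_
  rw [integral_mix hs ht (integrable_exp_of_abs_le hm hM) (integrable_exp_of_abs_le hm hM)] at h1
  rw [integral_mix hs ht (integrable_of_abs_le hm hM) (integrable_of_abs_le hm hM)]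
  -- In linearised form the two bounds add up: the exponential integrals recombine into that of the
  -- mixed second law, which is at most 1.
  have e0 := mul_le_mul_of_nonneg_left (integral_le_klDiv_add μ₀ ν₀ h₀ hm hM) hs
  have e1 := mul_le_mul_of_nonneg_left (integral_le_klDiv_add μ₁ ν₁ h₁ hm hM) ht
  nlinarith

end Divergence

/-! ### Chain rule for the divergence from a product law. -/

section ChainRule

variable {U X : Type*} [MeasurableSpace U] [MeasurableSpace X]

lemma map_snd_compProd (Q : Measure U) [SFinite Q] (κ : Kernel U X) [IsSFiniteKernel κ] :
    (Q ⊗ₘ κ).map Prod.snd = κ ∘ₘ Q := Measure.snd_compProd Q κ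

/-- For the converse direction: on a set null for Q × Q_X the density dQ_X/dπ vanishes Q × π-almost
everywhere, whereas it is positive almost surely under the joint law, whose second marginal is Q_X.
-/
lemma compProd_absolutelyContinuous_iff (Q : Measure U) [IsProbabilityMeasure Q] (κ : Kernel U X)
    [IsMarkovKernel κ] (π : Measure X) [IsProbabilityMeasure π] (hac : κ ∘ₘ Q ≪ π) :
    Q ⊗ₘ κ ≪ Q.prod (κ ∘ₘ Q) ↔ Q ⊗ₘ κ ≪ Q.prod π := by
  refine ⟨fun h => h.trans (Measure.AbsolutelyContinuous.rfl.prod hac), fun h => ?_⟩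
  refine Measure.AbsolutelyContinuous.mk fun s hs h0 => ?_
  have hg : Measurable fun z : U × X => (κ ∘ₘ Q).rnDeriv π z.2 :=
    (Measure.measurable_rnDeriv _ _).comp measurable_snd
  rw [← Measure.withDensity_rnDeriv_eq _ _ hac,
    prod_withDensity_right (Measure.measurable_rnDeriv _ _), withDensity_apply _ hs,
    setLIntegral_eq_zero_iff hs hg] at h0
  have hpos : ∀ᵐ z ∂(Q ⊗ₘ κ), 0 < (κ ∘ₘ Q).rnDeriv π z.2 := by
    have := Measure.rnDeriv_pos hac
    rw [← map_snd_compProd] at this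
    rw [← map_snd_compProd]
    exact ae_of_ae_map measurable_snd.aemeasurable this
  rw [measure_eq_zero_iff_ae_notMem]
  filter_upwards [hpos, h.ae_le h0] with z h1 h2 h3
  exact h1.ne' (h2 h3)

/-- Radon–Nikodym chain rule through Q × Q_X. The logarithm of the product splits because both
factors are positive and finite almost surely under the joint law. -/
lemma llr_compProd_eq_add (Q : Measure U) [IsProbabilityMeasure Q] (κ : Kernel U X)
    [IsMarkovKernel κ] (π : Measure X) [IsProbabilityMeasure π] (hac : κ ∘ₘ Q ≪ π)
    (h : Q ⊗ₘ κ ≪ Q.prod (κ ∘ₘ Q)) :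
    llr (Q ⊗ₘ κ) (Q.prod π)
      =ᵐ[Q ⊗ₘ κ] fun z => llr (Q ⊗ₘ κ) (Q.prod (κ ∘ₘ Q)) z + llr (κ ∘ₘ Q) π z.2 := by
  have hN : Q.prod (κ ∘ₘ Q) ≪ Q.prod π := Measure.AbsolutelyContinuous.rfl.prod hac
  have hM : Q ⊗ₘ κ ≪ Q.prod π := h.trans hN
  have hg : Measurable fun z : U × X => (κ ∘ₘ Q).rnDeriv π z.2 :=
    (Measure.measurable_rnDeriv _ _).comp measurable_snd
  have h1 : (Q.prod (κ ∘ₘ Q)).rnDeriv (Q.prod π)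
      =ᵐ[Q.prod π] fun z => (κ ∘ₘ Q).rnDeriv π z.2 := by
    have : Q.prod (κ ∘ₘ Q)
        = (Q.prod π).withDensity fun z => (κ ∘ₘ Q).rnDeriv π z.2 := by
      rw [← prod_withDensity_right (Measure.measurable_rnDeriv _ _),
        Measure.withDensity_rnDeriv_eq _ _ hac]
    conv_lhs => rw [this]
    exact Measure.rnDeriv_withDensity _ hg
  filter_upwards [hM.ae_le h1, hM.ae_le (Measure.rnDeriv_mul_rnDeriv h (κ := Q.prod π)),
    hM.ae_le (Measure.rnDeriv_ne_top (Q ⊗ₘ κ) (Q.prod π)), Measure.rnDeriv_pos hM,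
    h.ae_le (Measure.rnDeriv_ne_top (Q ⊗ₘ κ) (Q.prod (κ ∘ₘ Q))), Measure.rnDeriv_pos h]
    with z e1 e2 e3 e4 e5 e6
  rw [Pi.mul_apply, e1] at e2
  have e7 : (κ ∘ₘ Q).rnDeriv π z.2 ≠ 0 := fun h0 => by simp [← e2, h0] at e4
  have e8 : (κ ∘ₘ Q).rnDeriv π z.2 ≠ ∞ := fun h0 => by
    rw [h0, ENNReal.mul_top e6.ne'] at e2
    exact e3 e2.symm
  simp only [llr_def]
  rw [← e2, ENNReal.toReal_mul, Real.log_mul]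
  · exact (ENNReal.toReal_pos e6.ne' e5).ne'
  · exact (ENNReal.toReal_pos e7 e8).ne'

/-- `D(Q_{UX} ‖ Q_U × π) = D(Q_X ‖ π) + I(Q_U, Q_{X|U})` as soon as the first term is finite. -/
lemma klDiv_compProd_prod (Q : Measure U) [IsProbabilityMeasure Q] (κ : Kernel U X)
    [IsMarkovKernel κ] (π : Measure X) [IsProbabilityMeasure π] (hD : klDiv (κ ∘ₘ Q) π ≠ ∞) :
    klDiv (Q ⊗ₘ κ) (Q.prod π) = klDiv (κ ∘ₘ Q) π + mutualInfo Q κ := by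
  obtain ⟨hac, hint⟩ := klDiv_ne_top_iff.1 hD
  unfold mutualInfo
  by_cases h : Q ⊗ₘ κ ≪ Q.prod (κ ∘ₘ Q)
  swap
  · rw [klDiv_of_not_ac h, klDiv_of_not_ac fun h' =>
      h ((compProd_absolutelyContinuous_iff Q κ π hac).2 h'), add_top]
  have hM := (compProd_absolutelyContinuous_iff Q κ π hac).1 h
  have hllr := llr_compProd_eq_add Q κ π hac h
  have hmp : MeasurePreserving Prod.snd (Q ⊗ₘ κ) (κ ∘ₘ Q) :=
    ⟨measurable_snd, map_snd_compProd Q κ⟩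
  have hint2 : Integrable (fun z : U × X => llr (κ ∘ₘ Q) π z.2) (Q ⊗ₘ κ) :=
    hmp.integrable_comp_of_integrable hint
  have hval : ∫ z : U × X, llr (κ ∘ₘ Q) π z.2 ∂(Q ⊗ₘ κ) = ∫ x, llr (κ ∘ₘ Q) π x ∂(κ ∘ₘ Q) := by
    rw [← map_snd_compProd, integral_map measurable_snd.aemeasurable
      (measurable_llr _ _).aestronglyMeasurable]
  -- The two ratios of the pair differ by an integrable function, so they are integrable together;
  -- if neither is, both sides are infinite.
  by_cases hI : Integrable (llr (Q ⊗ₘ κ) (Q.prod (κ ∘ₘ Q))) (Q ⊗ₘ κ)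
  swap
  · rw [klDiv_of_not_integrable hI, klDiv_of_not_integrable, add_top]
    intro hcon
    refine hI (((integrable_congr hllr).1 hcon).sub hint2 |>.congr ?_)
    exact ae_of_all _ fun z => by simp
  have hI2 : Integrable (llr (Q ⊗ₘ κ) (Q.prod π)) (Q ⊗ₘ κ) :=
    (integrable_congr hllr).2 (hI.add hint2)
  rw [← ENNReal.toReal_eq_toReal_iff' (klDiv_ne_top hM hI2)
    (ENNReal.add_ne_top.2 ⟨hD, klDiv_ne_top h hI⟩), ENNReal.toReal_add hD (klDiv_ne_top h hI),
    toReal_klDiv_of_measure_eq hM (by simp), toReal_klDiv_of_measure_eq h (by simp),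
    toReal_klDiv_of_measure_eq hac (by simp), integral_congr_ae hllr, integral_add hI hint2, hval,
    add_comm]

end ChainRule


/-! ### Product laws: densities, Chernoff and Chebyshev bounds, law of large numbers. -/

section Products

variable {α : Type*} [MeasurableSpace α]

lemma lintegral_pi_prod {ι : Type*} [Fintype ι] (μ : ι → Measure α)
    [∀ i, IsProbabilityMeasure (μ i)] {f : ι → α → ℝ≥0∞} (hf : ∀ i, Measurable (f i)) :
    ∫⁻ z, ∏ i, f i (z i) ∂(Measure.pi μ) = ∏ i, ∫⁻ x, f i x ∂(μ i) := by
  have hind : iIndepFun (fun i (z : ι → α) => f i (z i)) (Measure.pi μ) :=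
    iIndepFun_pi fun i => (hf i).aemeasurable
  rw [lintegral_prod_eq_prod_lintegral_of_indepFun Finset.univ _ hind
    fun i => (hf i).comp (measurable_pi_apply i)]
  refine Finset.prod_congr rfl fun i _ => ?_
  rw [← (measurePreserving_eval μ i).map_eq, lintegral_map (hf i) (measurable_pi_apply i)]

instance {n : ℕ} (μ : Measure α) [IsProbabilityMeasure μ] : IsProbabilityMeasure (iidLaw n μ) := by
  unfold iidLaw; infer_instance

/-- The factors may vary with the coordinate, as they do for the output of a codeword. Boxes
suffice, and on them the integrand factorises. -/
lemma iidLaw_withDensity {n : ℕ} (π : Measure α) [IsProbabilityMeasure π] (μ : Fin n → Measure α)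
    [∀ i, IsProbabilityMeasure (μ i)] {f : Fin n → α → ℝ≥0∞} (hf : ∀ i, Measurable (f i))
    (h : ∀ i, μ i = π.withDensity (f i)) :
    Measure.pi μ = (iidLaw n π).withDensity fun z => ∏ i, f i (z i) := by
  refine Measure.pi_eq fun s hs => ?_
  have hbox : MeasurableSet (Set.univ.pi s) := MeasurableSet.univ_pi hs
  rw [withDensity_apply _ hbox, ← lintegral_indicator hbox]
  have : ∀ z : Fin n → α, (Set.univ.pi s).indicator (fun z => ∏ i, f i (z i)) z
      = ∏ i, (s i).indicator (f i) (z i) := by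
    intro z
    by_cases hz : z ∈ Set.univ.pi s
    · rw [Set.indicator_of_mem hz]
      exact Finset.prod_congr rfl fun i _ => by
        rw [Set.indicator_of_mem (hz i (Set.mem_univ i))]
    · rw [Set.indicator_of_notMem hz]
      simp only [Set.mem_pi, Set.mem_univ, true_implies, not_forall] at hz
      obtain ⟨i, hi⟩ := hz
      exact (Finset.prod_eq_zero (Finset.mem_univ i) (Set.indicator_of_notMem hi _)).symm
  simp_rw [this]
  rw [iidLaw, lintegral_pi_prod _ fun i => (hf i).indicator (hs i)]
  refine Finset.prod_congr rfl fun i _ => ?_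
  rw [lintegral_indicator (hs i), h i, withDensity_apply _ (hs i)]

/-- Chernoff bound for an exponentially normalised sum. -/
lemma pi_sum_ge_le {n : ℕ} (μ : Fin n → Measure α) [∀ i, IsProbabilityMeasure (μ i)]
    {h : Fin n → α → ℝ} (hm : ∀ i, Measurable (h i)) {M : ℝ} (hM : ∀ i x, |h i x| ≤ M)
    (h1 : ∀ i, ∫ x, Real.exp (h i x) ∂(μ i) ≤ 1) (a : ℝ) :
    Measure.pi μ {z | n * a ≤ ∑ i, h i (z i)} ≤ ENNReal.ofReal (Real.exp (-(n * a))) := by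
  have hmeas : Measurable fun z : Fin n → α => ∑ i, h i (z i) :=
    Finset.measurable_sum _ fun i _ => (hm i).comp (measurable_pi_apply i)
  have hprod : ∫⁻ z, ENNReal.ofReal (Real.exp (∑ i, h i (z i))) ∂(Measure.pi μ) ≤ 1 := by
    have : ∀ z : Fin n → α, ENNReal.ofReal (Real.exp (∑ i, h i (z i)))
        = ∏ i, ENNReal.ofReal (Real.exp (h i (z i))) := fun z => by
      rw [Real.exp_sum, ENNReal.ofReal_prod_of_nonneg fun i _ => (Real.exp_pos _).le]
    simp_rw [this]
    rw [lintegral_pi_prod μ fun i => (hm i).exp.ennreal_ofReal]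
    refine Finset.prod_le_one' fun i _ => ?_
    rw [← ofReal_integral_eq_lintegral_ofReal (integrable_exp_of_abs_le (hm i) (hM i))
      (ae_of_all _ fun x => (Real.exp_pos _).le)]
    exact ENNReal.ofReal_le_one.2 (h1 i)
  have hset : {z : Fin n → α | n * a ≤ ∑ i, h i (z i)}
      = {z | ENNReal.ofReal (Real.exp (n * a)) ≤ ENNReal.ofReal (Real.exp (∑ i, h i (z i)))} := by
    ext z
    simp [ENNReal.ofReal_le_ofReal_iff (Real.exp_pos _).le]
  rw [hset]
  refine (meas_ge_le_lintegral_div hmeas.exp.ennreal_ofReal.aemeasurable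
    (by simp [Real.exp_pos]) ENNReal.ofReal_ne_top).trans ?_
  rw [Real.exp_neg, ENNReal.ofReal_inv_of_pos (Real.exp_pos _), ← one_div]
  gcongr

/-- Chebyshev bound for a sum of independent bounded terms. -/
lemma pi_sum_lt_le {n : ℕ} (hn : 0 < n) (μ : Fin n → Measure α)
    [∀ i, IsProbabilityMeasure (μ i)]
    {h : Fin n → α → ℝ} (hm : ∀ i, Measurable (h i)) {M : ℝ} (hM : ∀ i x, |h i x| ≤ M)
    {a δ : ℝ} (hδ : 0 < δ) (ha : n * (a + δ) ≤ ∑ i, ∫ x, h i x ∂(μ i)) :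
    Measure.pi μ {z | ∑ i, h i (z i) < n * a} ≤ ENNReal.ofReal (M ^ 2 / (n * δ ^ 2)) := by
  have hn' : (0 : ℝ) < n := Nat.cast_pos.2 hn
  have hL2 : ∀ i, MemLp (h i) 2 (μ i) := fun i =>
    MemLp.of_bound (hm i).aestronglyMeasurable M (ae_of_all _ (hM i))
  set S : (Fin n → α) → ℝ := ∑ i, fun z => h i (z i) with hS
  have hSz : ∀ z, S z = ∑ i, h i (z i) := fun z => by rw [hS, Finset.sum_apply]
  have hSL2 : MemLp S 2 (Measure.pi μ) :=
    memLp_finsetSum' _ fun i _ => (hL2 i).comp_measurePreserving (measurePreserving_eval μ i)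
  have hmean : ∫ z, S z ∂(Measure.pi μ) = ∑ i, ∫ x, h i x ∂(μ i) := by
    simp_rw [hSz]
    have hint : ∀ i, Integrable (fun z : Fin n → α => h i (z i)) (Measure.pi μ) := fun i =>
      (measurePreserving_eval μ i).integrable_comp_of_integrable
        ((hL2 i).integrable (by norm_num))
    rw [integral_finsetSum _ fun i _ => hint i]
    refine Finset.sum_congr rfl fun i _ => ?_
    exact integral_comp_eval (hm i).aestronglyMeasurable
  have hvar : Var[S; Measure.pi μ] ≤ n * M ^ 2 := by
    rw [hS, variance_sum_pi hL2]
    calc ∑ i, Var[h i; μ i] ≤ ∑ _i : Fin n, M ^ 2 := by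
          refine Finset.sum_le_sum fun i _ => ?_
          have := variance_le_sq_of_bounded (μ := μ i) (X := h i) (a := -M) (b := M)
            (ae_of_all _ fun x => abs_le.1 (hM i x)) (hm i).aemeasurable
          refine this.trans (le_of_eq ?_)
          ring
      _ = n * M ^ 2 := by simp
  have hsub : {z : Fin n → α | ∑ i, h i (z i) < n * a}
      ⊆ {z | n * δ ≤ |S z - ∫ z, S z ∂(Measure.pi μ)|} := by
    intro z hz
    have hz' : ∑ i, h i (z i) < n * a := hz
    change n * δ ≤ |S z - ∫ z, S z ∂(Measure.pi μ)|
    rw [hmean, hSz, abs_sub_comm]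
    refine le_trans ?_ (le_abs_self _)
    linarith
  refine (measure_mono hsub).trans
    ((meas_ge_le_variance_div_sq hSL2 (mul_pos hn' hδ)).trans (ENNReal.ofReal_le_ofReal ?_))
  calc Var[S; Measure.pi μ] / (n * δ) ^ 2 ≤ n * M ^ 2 / (n * δ) ^ 2 := by gcongr
    _ = M ^ 2 / (n * δ ^ 2) := by field_simp

/-- The upper half of the weak law of large numbers, for a merely integrable summand. -/
lemma tendsto_iidLaw_sum_ge (μ : Measure α) [IsProbabilityMeasure μ] {h : α → ℝ}
    (hm : Measurable h) (hi : Integrable h μ) {a : ℝ} (ha : ∫ x, h x ∂μ < a) :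
    Tendsto (fun n : ℕ => iidLaw n μ {z | n * a ≤ ∑ i, h (z i)}) atTop (𝓝 0) := by
  -- A log-likelihood ratio may have infinite variance, so the strong law on the infinite product
  -- replaces Chebyshev's inequality.
  set P : Measure (ℕ → α) := Measure.infinitePi fun _ => μ with hP
  have hmp : ∀ k, MeasurePreserving (fun ω : ℕ → α => ω k) P μ := fun k =>
    ⟨measurable_pi_apply k, Measure.infinitePi_map_eval (fun _ => μ) k⟩
  have hXm : ∀ k, Measurable fun ω : ℕ → α => h (ω k) := fun k =>
    hm.comp (measurable_pi_apply k)
  have hsl := strong_law_ae_real (μ := P) (fun k ω => h (ω k))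
    ((hmp 0).integrable_comp_of_integrable hi)
    (fun i j hij => (iIndepFun_infinitePi (P := fun _ : ℕ => μ) (X := fun _ => h)
      fun _ => hm).indepFun hij)
    (fun k => ⟨(hXm k).aemeasurable, (hXm 0).aemeasurable, by
      have e : ∀ k, P.map (fun ω : ℕ → α => h (ω k)) = μ.map h := fun k => by
        rw [← (hmp k).map_eq, Measure.map_map hm (hmp k).measurable]
        rfl
      rw [e, e]⟩)
  have hmean : ∫ ω, h (ω 0) ∂P = ∫ x, h x ∂μ := by
    rw [← (hmp 0).map_eq, integral_map (hmp 0).measurable.aemeasurable hm.aestronglyMeasurable]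
  rw [hmean] at hsl
  have hIM := tendstoInMeasure_of_tendsto_ae (μ := P)
    (f := fun (n : ℕ) ω => (∑ i ∈ Finset.range n, h (ω i)) / n) (g := fun _ => ∫ x, h x ∂μ)
    (fun n => ((Finset.measurable_sum _ fun i _ => hXm i).div_const _).aestronglyMeasurable) hsl
  have hIM' := hIM (ENNReal.ofReal (a - ∫ x, h x ∂μ)) (by simpa using ha)
  refine tendsto_of_tendsto_of_tendsto_of_le_of_le' tendsto_const_nhds hIM'
    (Eventually.of_forall fun _ => zero_le) ?_
  filter_upwards [eventually_gt_atTop 0] with n hn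
  have hn' : (0 : ℝ) < n := Nat.cast_pos.2 hn
  have hmap : iidLaw n μ = P.map fun ω (i : Fin n) => ω i := by
    rw [hP, Measure.map_infinitePi_infinitePi_of_inj Fin.val_injective,
      Measure.infinitePi_eq_pi, iidLaw]
  have hSm : Measurable fun z : Fin n → α => ∑ i, h (z i) :=
    Finset.measurable_sum _ fun i _ => hm.comp (measurable_pi_apply i)
  rw [hmap, Measure.map_apply (by fun_prop) (measurableSet_le measurable_const hSm)]
  refine measure_mono fun ω hω => ?_
  have hω' : n * a ≤ ∑ i : Fin n, h (ω i) := hω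
  rw [Fin.sum_univ_eq_sum_range fun i => h (ω i)] at hω'
  change _ ≤ edist _ _
  rw [edist_dist, Real.dist_eq]
  refine ENNReal.ofReal_le_ofReal (le_trans ?_ (le_abs_self _))
  have : a ≤ (∑ i ∈ Finset.range n, h (ω i)) / n := by
    rw [le_div_iff₀ hn']
    linarith
  linarith

end Products

/-! ### The memoryless block channel. -/

section Block

variable {U X : Type*} [MeasurableSpace U] [MeasurableSpace X]

/-- The memoryless channel `κ^{⊗n}`. -/
def blockKernel (κ : Kernel U X) [IsMarkovKernel κ] (n : ℕ) :
    Kernel (Fin n → U) (Fin n → X) where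
  toFun u := Measure.pi fun i => κ (u i)
  measurable' := by
    refine Measurable.measure_of_isPiSystem_of_isProbabilityMeasure generateFrom_pi.symm
      isPiSystem_pi ?_
    rintro s ⟨t, ht, rfl⟩
    simp only [Measure.pi_pi]
    refine Finset.measurable_prod _ fun i _ => ?_
    exact (Kernel.measurable_coe κ (ht i (Set.mem_univ i))).comp (measurable_pi_apply i)

lemma blockKernel_apply (κ : Kernel U X) [IsMarkovKernel κ] (n : ℕ) (u : Fin n → U) :
    blockKernel κ n u = Measure.pi fun i => κ (u i) := rfl

instance (κ : Kernel U X) [IsMarkovKernel κ] (n : ℕ) : IsMarkovKernel (blockKernel κ n) :=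
  ⟨fun u => by rw [blockKernel_apply]; infer_instance⟩

/-- Regrouping a word and its output into letter pairs makes the joint law i.i.d., so additive
statistics of the pair become i.i.d. sums. -/
lemma map_iidLaw_compProd (Q : Measure U) [IsProbabilityMeasure Q] (κ : Kernel U X)
    [IsMarkovKernel κ] (n : ℕ) :
    iidLaw n Q ⊗ₘ blockKernel κ n
      = (iidLaw n (Q ⊗ₘ κ)).map (MeasurableEquiv.arrowProdEquivProdArrow U X (Fin n)) := by
  set e := MeasurableEquiv.arrowProdEquivProdArrow U X (Fin n) with he
  suffices h : iidLaw n (Q ⊗ₘ κ) = (iidLaw n Q ⊗ₘ blockKernel κ n).map e.symm by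
    rw [h, Measure.map_map e.measurable e.symm.measurable]
    simp
  refine Measure.pi_eq fun s hs => ?_
  rw [Measure.map_apply e.symm.measurable (MeasurableSet.univ_pi hs),
    Measure.compProd_apply (e.symm.measurable (MeasurableSet.univ_pi hs))]
  have : ∀ u : Fin n → U,
      blockKernel κ n u (Prod.mk u ⁻¹' (e.symm ⁻¹' Set.univ.pi s))
        = ∏ i, κ (u i) (Prod.mk (u i) ⁻¹' s i) := by
    intro u
    rw [blockKernel_apply, ← Measure.pi_pi]
    congr 1
  simp_rw [this]
  rw [iidLaw, lintegral_pi_prod (fun _ : Fin n => Q)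
    (f := fun i u => κ u (Prod.mk u ⁻¹' s i))
    fun i => Kernel.measurable_kernel_prodMk_left (hs i)]
  exact Finset.prod_congr rfl fun i _ => (Measure.compProd_apply (hs i)).symm

lemma map_iidLaw_prod (Q : Measure U) [IsProbabilityMeasure Q] (π : Measure X)
    [IsProbabilityMeasure π] (n : ℕ) :
    (iidLaw n Q).prod (iidLaw n π)
      = (iidLaw n (Q.prod π)).map (MeasurableEquiv.arrowProdEquivProdArrow U X (Fin n)) :=
  (measurePreserving_arrowProdEquivProdArrow U X (Fin n) (fun _ => Q) fun _ => π).map_eq.symm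

lemma comp_blockKernel (Q : Measure U) [IsProbabilityMeasure Q] (κ : Kernel U X)
    [IsMarkovKernel κ] (n : ℕ) :
    blockKernel κ n ∘ₘ iidLaw n Q = iidLaw n (κ ∘ₘ Q) := by
  have hmap : iidLaw n ((Q ⊗ₘ κ).map Prod.snd)
      = (iidLaw n (Q ⊗ₘ κ)).map fun z i => (z i).2 :=
    (Measure.pi_map_pi (μ := fun _ : Fin n => Q ⊗ₘ κ)
      fun _ => measurable_snd.aemeasurable).symm
  rw [← map_snd_compProd, ← map_snd_compProd, map_iidLaw_compProd, hmap,
    Measure.map_map measurable_snd (MeasurableEquiv.measurable _)]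
  rfl

end Block


/-! ### One-shot bounds for random codebooks. -/

section OneShot

variable {V Y : Type*} [MeasurableSpace V] [MeasurableSpace Y]

/-- The output law of the channel `W` for an equiprobable choice from the codebook `c`. -/
def mixOutput (W : Kernel V Y) {L : ℕ} (c : Fin L → V) : Measure Y :=
  (L : ℝ≥0∞)⁻¹ • ∑ l, W (c l)

lemma mixOutput_apply (W : Kernel V Y) {L : ℕ} (c : Fin L → V) (s : Set Y) :
    mixOutput W c s = (L : ℝ≥0∞)⁻¹ * ∑ l, W (c l) s := by
  simp [mixOutput, Measure.finsetSum_apply]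

lemma isProbabilityMeasure_mixOutput (W : Kernel V Y) [IsMarkovKernel W] {L : ℕ} (hL : 1 ≤ L)
    (c : Fin L → V) : IsProbabilityMeasure (mixOutput W c) := by
  constructor
  rw [mixOutput_apply]
  simp only [measure_univ, Finset.sum_const, Finset.card_univ, Fintype.card_fin, nsmul_eq_mul,
    mul_one]
  exact ENNReal.inv_mul_cancel (by simp; omega) (by simp)

lemma lintegral_pi_eval {L : ℕ} (μ : Measure V) [IsProbabilityMeasure μ] (l : Fin L)
    {f : V → ℝ≥0∞} (hf : Measurable f) :
    ∫⁻ c, f (c l) ∂(Measure.pi fun _ : Fin L => μ) = ∫⁻ v, f v ∂μ :=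
  (measurePreserving_eval (fun _ : Fin L => μ) l).lintegral_comp hf

lemma lintegral_inv_mul_sum {L : ℕ} (hL : 1 ≤ L) (μ : Measure V) [IsProbabilityMeasure μ]
    {f : V → ℝ≥0∞} (hf : Measurable f) :
    ∫⁻ c, (L : ℝ≥0∞)⁻¹ * ∑ l, f (c l) ∂(Measure.pi fun _ : Fin L => μ) = ∫⁻ v, f v ∂μ := by
  have hm : ∀ l : Fin L, Measurable fun c : Fin L → V => f (c l) := fun l =>
    hf.comp (measurable_pi_apply l)
  rw [lintegral_const_mul _ (Finset.measurable_sum _ fun l _ => hm l),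
    lintegral_finsetSum _ fun l _ => hm l]
  simp_rw [lintegral_pi_eval μ _ hf]
  rw [Finset.sum_const, Finset.card_univ, Fintype.card_fin, nsmul_eq_mul, ← mul_assoc,
    ENNReal.inv_mul_cancel (by simp; omega) (by simp), one_mul]

/-- Lower bound on the average `E_γ` by a test that does not look at the codebook. -/
lemma comp_sub_le_lintegral_eGamma {L : ℕ} (hL : 1 ≤ L) (μ : Measure V) [IsProbabilityMeasure μ]
    (W : Kernel V Y) [IsMarkovKernel W] (ν : Measure Y) [IsProbabilityMeasure ν] {γ : ℝ≥0∞}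
    (hγ : γ ≠ ∞) {A : Set Y} (hA : MeasurableSet A) :
    (W ∘ₘ μ) A - γ * ν A
      ≤ ∫⁻ c, eGamma γ (mixOutput W c) ν ∂(Measure.pi fun _ : Fin L => μ) := by
  calc (W ∘ₘ μ) A - γ * ν A
      = ∫⁻ c, (L : ℝ≥0∞)⁻¹ * ∑ l, W (c l) A ∂(Measure.pi fun _ : Fin L => μ)
          - ∫⁻ _, γ * ν A ∂(Measure.pi fun _ : Fin L => μ) := by
        rw [lintegral_inv_mul_sum hL μ (Kernel.measurable_coe W hA),
          Measure.bind_apply hA W.aemeasurable]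
        simp
    _ ≤ _ := (lintegral_sub_le _ _ measurable_const).trans (lintegral_mono fun c => ?_)
  have := isProbabilityMeasure_mixOutput W hL c
  rw [← mixOutput_apply]
  exact measure_sub_mul_le_eGamma _ _ hγ hA

/-- Lower bound on the average `E_γ` by the union over the codewords of a test of the pair. -/
lemma compProd_sub_le_lintegral_eGamma {L : ℕ} (hL : 1 ≤ L) (μ : Measure V)
    [IsProbabilityMeasure μ] (W : Kernel V Y) [IsMarkovKernel W] (ν : Measure Y)
    [IsProbabilityMeasure ν] {γ : ℝ≥0∞} (hγ : γ ≠ ∞) {S : Set (V × Y)} (hS : MeasurableSet S) :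
    (μ ⊗ₘ W) S - γ * (L * (μ.prod ν) S)
      ≤ ∫⁻ c, eGamma γ (mixOutput W c) ν ∂(Measure.pi fun _ : Fin L => μ) := by
  have hW : Measurable fun v => W v (Prod.mk v ⁻¹' S) := Kernel.measurable_kernel_prodMk_left hS
  have hν : Measurable fun v => ν (Prod.mk v ⁻¹' S) := measurable_measure_prodMk_left hS
  have hνl : ∀ l : Fin L, Measurable fun c : Fin L → V => ν (Prod.mk (c l) ⁻¹' S) := fun l =>
    hν.comp (measurable_pi_apply l)
  calc (μ ⊗ₘ W) S - γ * (L * (μ.prod ν) S)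
      = ∫⁻ c, (L : ℝ≥0∞)⁻¹ * ∑ l, W (c l) (Prod.mk (c l) ⁻¹' S) ∂(Measure.pi fun _ : Fin L => μ)
          - ∫⁻ c, γ * ∑ l, ν (Prod.mk (c l) ⁻¹' S) ∂(Measure.pi fun _ : Fin L => μ) := by
        rw [lintegral_inv_mul_sum hL μ hW, Measure.compProd_apply hS,
          lintegral_const_mul _ (Finset.measurable_sum _ fun l _ => hνl l),
          lintegral_finsetSum _ fun l _ => hνl l]
        simp_rw [lintegral_pi_eval μ _ hν]
        rw [Measure.prod_apply hS]
        simp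
    _ ≤ _ := (lintegral_sub_le _ _
          ((Finset.measurable_sum _ fun l _ => hνl l).const_mul γ)).trans
            (lintegral_mono fun c => ?_)
  have := isProbabilityMeasure_mixOutput W hL c
  -- Each codeword's output charges `A` at least as much as its own section; under `ν` the union
  -- bound sums all `L` sections.
  set A : Set Y := ⋃ l, Prod.mk (c l) ⁻¹' S with hA
  have hAm : MeasurableSet A := MeasurableSet.iUnion fun l => measurable_prodMk_left hS
  refine le_trans ?_ (measure_sub_mul_le_eGamma _ _ hγ hAm)
  rw [mixOutput_apply]
  refine tsub_le_tsub ?_ ?_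
  · gcongr with l
    exact Set.subset_iUnion (fun l => Prod.mk (c l) ⁻¹' S) l
  · gcongr
    exact measure_iUnion_fintype_le _ _

lemma lintegral_pi_eval_pair {L : ℕ} (μ : Measure V) [IsProbabilityMeasure μ] {l m : Fin L}
    (hlm : l ≠ m) {f : V × V → ℝ≥0∞} (hf : Measurable f) :
    ∫⁻ c, f (c l, c m) ∂(Measure.pi fun _ : Fin L => μ) = ∫⁻ p, f p ∂(μ.prod μ) := by
  rw [← Measure.infinitePi_map_eval_prod (P := fun _ : Fin L => μ) hlm,
    lintegral_map hf (by fun_prop), Measure.infinitePi_eq_pi]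

/-- Soft covering for the excess information: the average over random codebooks is controlled by
the joint density of a codeword with its own output, and by the density of the output law. -/
lemma lintegral_excessInfo_le {L : ℕ} (hL : 1 ≤ L) (μ : Measure V) [IsProbabilityMeasure μ]
    (W : Kernel V Y) [IsMarkovKernel W] (ν : Measure Y) [IsProbabilityMeasure ν]
    {F : V → Y → ℝ≥0∞} (hF : Measurable (Function.uncurry F))
    (hW : ∀ᵐ v ∂μ, W v = ν.withDensity (F v)) {γ : ℝ≥0∞} (hγ0 : γ ≠ 0) (hγ : γ ≠ ∞) (t : ℝ≥0∞) :
    ∫⁻ c, excessInfo γ (mixOutput W c) ν ∂(Measure.pi fun _ : Fin L => μ)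
      ≤ (μ ⊗ₘ W) {p | γ * L / 2 < F p.1 p.2} + (W ∘ₘ μ) {y | t < ∫⁻ v, F v y ∂μ}
        + 2 * t / γ := by
  have hL0 : (L : ℝ≥0∞) ≠ 0 := by simp; omega
  have hLt : (L : ℝ≥0∞) ≠ ∞ := by simp
  set g : Y → ℝ≥0∞ := fun y => ∫⁻ v, F v y ∂μ with hg
  have hgm : Measurable g := hF.lintegral_prod_left'
  set G : Set Y := {y | g y ≤ t} with hG
  have hGm : MeasurableSet G := measurableSet_le hgm measurable_const
  have hTm : MeasurableSet {y | t < g y} := measurableSet_lt measurable_const hgm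
  set S : Set (V × Y) := {p | γ * L / 2 < F p.1 p.2} with hS
  have hSm : MeasurableSet S := measurableSet_lt measurable_const hF
  -- If ∑ F(c_m, y) > γL, either the own term exceeds `K` or the remaining terms sum to at least
  -- `K`.
  set K : ℝ≥0∞ := γ * L / 2 with hK
  have hK0 : K ≠ 0 := by simp [hK, ENNReal.div_eq_zero_iff, hγ0, hL0]
  have hKt : K ≠ ∞ := ENNReal.div_ne_top (ENNReal.mul_ne_top hγ hLt) (by simp)
  -- Contribution of a foreign codeword `p.2` to the density at an output of `p.1`. Averaging over
  -- `p.2` first gives `g y`, which the truncation to `G` keeps below `t`.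
  set Φ : V × V → ℝ≥0∞ := fun p => ∫⁻ y, G.indicator (F p.2) y ∂(W p.1) with hΦ
  have hind : Measurable fun q : (V × V) × Y => G.indicator (F q.1.2) q.2 := by
    have : (fun q : (V × V) × Y => G.indicator (F q.1.2) q.2)
        = (Prod.snd ⁻¹' G).indicator fun q : (V × V) × Y => F q.1.2 q.2 := by
      ext q
      by_cases hq : q.2 ∈ G <;> simp [hq]
    rw [this]
    exact (hF.comp ((measurable_snd.comp measurable_fst).prodMk measurable_snd)).indicator
      (measurable_snd hGm)
  have hΦm : Measurable Φ :=
    Measurable.lintegral_kernel_prod_right (κ := W.comap Prod.fst measurable_fst) hind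
  have hΦle : ∫⁻ p, Φ p ∂(μ.prod μ) ≤ t := by
    rw [lintegral_prod _ hΦm.aemeasurable]
    calc ∫⁻ v, ∫⁻ v', Φ (v, v') ∂μ ∂μ ≤ ∫⁻ _, t ∂μ := lintegral_mono fun v => ?_
      _ = t := by simp
    have hind' : Measurable (Function.uncurry fun v' y => G.indicator (F v') y) :=
      hind.comp (f := fun q : V × Y => ((v, q.1), q.2)) (by fun_prop)
    calc ∫⁻ v', Φ (v, v') ∂μ = ∫⁻ y, ∫⁻ v', G.indicator (F v') y ∂μ ∂(W v) := by
          simp only [hΦ]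
          exact lintegral_lintegral_swap hind'.aemeasurable
      _ ≤ ∫⁻ _, t ∂(W v) := lintegral_mono fun y => ?_
      _ = t := by simp
    by_cases hy : y ∈ G
    · simp only [Set.indicator_of_mem hy]
      exact hy
    · simp [hy]
  have hWS : Measurable fun v => W v (Prod.mk v ⁻¹' S) := Kernel.measurable_kernel_prodMk_left hSm
  have hWT : Measurable fun v => W v {y | t < g y} := Kernel.measurable_coe W hTm
  have hae : ∀ᵐ c ∂(Measure.pi fun _ : Fin L => μ), ∀ l, W (c l) = ν.withDensity (F (c l)) :=
    ae_all_iff.2 fun l =>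
      (measurePreserving_eval (fun _ : Fin L => μ) l).quasiMeasurePreserving.ae hW
  have hpt : ∀ᵐ c ∂(Measure.pi fun _ : Fin L => μ), excessInfo γ (mixOutput W c) ν
      ≤ (L : ℝ≥0∞)⁻¹ * ∑ l, (W (c l) (Prod.mk (c l) ⁻¹' S) + W (c l) {y | t < g y})
        + (L : ℝ≥0∞)⁻¹ * (K⁻¹ * ∑ l, ∑ m ∈ Finset.univ.erase l, Φ (c l, c m)) := by
    filter_upwards [hae] with c hc
    have := isProbabilityMeasure_mixOutput W hL c
    have hFm : ∀ v, Measurable (F v) := fun v => hF.comp measurable_prodMk_left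
    have hdens : mixOutput W c = ν.withDensity fun y => (L : ℝ≥0∞)⁻¹ * ∑ l, F (c l) y := by
      ext s hs
      rw [mixOutput_apply, withDensity_apply _ hs,
        lintegral_const_mul _ (Finset.measurable_sum _ fun l _ => hFm _),
        lintegral_finsetSum _ fun l _ => hFm _]
      congr 1
      refine Finset.sum_congr rfl fun l _ => ?_
      conv_lhs => rw [hc l]
      rw [withDensity_apply _ hs]
    rw [excessInfo_of_withDensity _ ν
      ((Finset.measurable_sum _ fun l _ => hFm (c l)).const_mul _) hdens, mixOutput_apply,
      ← mul_add]
    gcongr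
    rw [Finset.mul_sum, ← Finset.sum_add_distrib]
    refine Finset.sum_le_sum fun l _ => ?_
    have hsub : {y | γ < (L : ℝ≥0∞)⁻¹ * ∑ m, F (c m) y}
        ⊆ (Prod.mk (c l) ⁻¹' S ∪ {y | t < g y})
          ∪ {y | K ≤ ∑ m ∈ Finset.univ.erase l, G.indicator (F (c m)) y} := by
      intro y hy
      by_contra hcon
      simp only [Set.mem_union, not_or, Set.mem_preimage, hS, Set.mem_ofPred_eq, not_lt,
        not_le] at hcon
      obtain ⟨⟨h1, h2⟩, h3⟩ := hcon
      have hyG : y ∈ G := h2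
      simp only [Set.indicator_of_mem hyG] at h3
      have h4 : ∑ m, F (c m) y < K + K := by
        rw [← Finset.add_sum_erase _ _ (Finset.mem_univ l)]
        exact ENNReal.add_lt_add_of_le_of_lt (ne_top_of_le_ne_top hKt h1) h1 h3
      rw [hK, ENNReal.add_halves] at h4
      have h5 : γ < (L : ℝ≥0∞)⁻¹ * ∑ m, F (c m) y := hy
      refine absurd h5 (not_lt.2 ?_)
      rw [mul_comm, ← div_eq_mul_inv]
      exact ENNReal.div_le_of_le_mul h4.le
    refine (measure_mono hsub).trans ((measure_union_le _ _).trans ?_)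
    refine add_le_add (measure_union_le _ _) ?_
    have hsm : ∀ m, Measurable (G.indicator (F (c m))) := fun m => (hFm _).indicator hGm
    refine (meas_ge_le_lintegral_div
      (Finset.measurable_sum _ fun m _ => hsm m).aemeasurable hK0 hKt).trans ?_
    rw [lintegral_finsetSum _ fun m _ => hsm m, div_eq_mul_inv, mul_comm]
  refine (lintegral_mono_ae hpt).trans ?_
  have hΦlm : ∀ l m : Fin L, Measurable fun c : Fin L → V => Φ (c l, c m) := fun l m =>
    hΦm.comp ((measurable_pi_apply l).prodMk (measurable_pi_apply m))
  rw [lintegral_add_right _ (((Finset.measurable_sum _ fun l _ =>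
    Finset.measurable_sum _ fun m _ => hΦlm l m).const_mul _).const_mul _)]
  refine add_le_add (le_of_eq ?_) ?_
  · rw [lintegral_inv_mul_sum hL μ (f := fun v => W v (Prod.mk v ⁻¹' S) + W v {y | t < g y})
      (hWS.add hWT), lintegral_add_right _ hWT, Measure.compProd_apply hSm,
      Measure.bind_apply hTm W.aemeasurable]
  · rw [lintegral_const_mul _ ((Finset.measurable_sum _ fun l _ =>
      Finset.measurable_sum _ fun m _ => hΦlm l m).const_mul _),
      lintegral_const_mul _ (Finset.measurable_sum _ fun l _ =>
        Finset.measurable_sum _ fun m _ => hΦlm l m),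
      lintegral_finsetSum _ fun l _ => Finset.measurable_sum _ fun m _ => hΦlm l m]
    have h1 : ∀ l : Fin L, ∫⁻ c, ∑ m ∈ Finset.univ.erase l, Φ (c l, c m)
        ∂(Measure.pi fun _ : Fin L => μ) ≤ L * t := by
      intro l
      rw [lintegral_finsetSum _ fun m _ => hΦlm l m]
      calc _ ≤ ∑ m ∈ Finset.univ.erase l, t := Finset.sum_le_sum fun m hm => by
            rw [lintegral_pi_eval_pair μ (Finset.ne_of_mem_erase hm).symm hΦm]
            exact hΦle
        _ ≤ ∑ m : Fin L, t := Finset.sum_le_sum_of_subset (Finset.erase_subset _ _)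
        _ = L * t := by simp
    calc _ ≤ (L : ℝ≥0∞)⁻¹ * (K⁻¹ * ∑ _l : Fin L, L * t) := by
          gcongr with l
          exact h1 l
      _ = ((L : ℝ≥0∞)⁻¹ * L) * (K⁻¹ * (L * t)) := by
          rw [Finset.sum_const, Finset.card_univ, Fintype.card_fin, nsmul_eq_mul]
          ring
      _ = 2 * t / γ := by
          rw [ENNReal.inv_mul_cancel hL0 hLt, one_mul, hK, ENNReal.inv_div (by simp) (by simp),
            div_eq_mul_inv, div_eq_mul_inv, ENNReal.mul_inv (Or.inl hγ0) (Or.inl hγ)]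
          calc 2 * (γ⁻¹ * (L : ℝ≥0∞)⁻¹) * (L * t) = 2 * t * γ⁻¹ * ((L : ℝ≥0∞)⁻¹ * L) := by ring
            _ = _ := by rw [ENNReal.inv_mul_cancel hL0 hLt, mul_one]

end OneShot


/-! ### Achievability for random codebooks. -/

section Achievability

lemma withDensity_ae_eq_exp_llr {α : Type*} [MeasurableSpace α] {μ ν : Measure α}
    [IsProbabilityMeasure μ] [IsProbabilityMeasure ν] {f : α → ℝ≥0∞} (hf : Measurable f)
    (h : μ = ν.withDensity f) : f =ᵐ[μ] fun x => ENNReal.ofReal (Real.exp (llr μ ν x)) := by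
  have hac : μ ≪ ν := by rw [h]; exact withDensity_absolutelyContinuous _ _
  have h1 : μ.rnDeriv ν =ᵐ[ν] f := by
    conv_lhs => rw [h]
    exact Measure.rnDeriv_withDensity _ hf
  filter_upwards [hac.ae_le h1, hac.ae_le (Measure.rnDeriv_ne_top μ ν), exp_llr_of_ac μ ν hac]
    with x hx1 hx2 hx3
  rw [hx3, ENNReal.ofReal_toReal hx2, hx1]

/-- The `n`-fold density exceeds `exp(na)` with vanishing probability for `a` above the mean of
the log-likelihood ratio. -/
lemma tendsto_iidLaw_density_gt {α : Type*} [MeasurableSpace α] {μ ν : Measure α}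
    [IsProbabilityMeasure μ] [IsProbabilityMeasure ν] {f : α → ℝ≥0∞} (hf : Measurable f)
    (h : μ = ν.withDensity f) (hi : Integrable (llr μ ν) μ) {a : ℝ} (ha : ∫ x, llr μ ν x ∂μ < a)
    {T : ℕ → ℝ≥0∞} (hT : ∀ᶠ n : ℕ in atTop, ENNReal.ofReal (Real.exp (n * a)) ≤ T n) :
    Tendsto (fun n : ℕ => iidLaw n μ {z | T n < ∏ i, f (z i)}) atTop (𝓝 0) := by
  refine tendsto_of_tendsto_of_tendsto_of_le_of_le' tendsto_const_nhds
    (tendsto_iidLaw_sum_ge μ (measurable_llr μ ν) hi ha)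
    (Eventually.of_forall fun _ => zero_le) ?_
  filter_upwards [hT] with n hn
  refine measure_mono_ae ?_
  have hae : ∀ᵐ z ∂(iidLaw n μ), ∀ i, f (z i) = ENNReal.ofReal (Real.exp (llr μ ν (z i))) :=
    ae_all_iff.2 fun i => (measurePreserving_eval (fun _ : Fin n => μ) i).quasiMeasurePreserving.ae
      (withDensity_ae_eq_exp_llr hf h)
  filter_upwards [hae] with z hz hlt
  have h1 : T n < ∏ i, f (z i) := hlt
  simp_rw [hz] at h1
  rw [← ENNReal.ofReal_prod_of_nonneg fun i _ => (Real.exp_pos _).le, ← Real.exp_sum] at h1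
  have h2 := (ENNReal.ofReal_lt_ofReal_iff'.1 (hn.trans_lt h1)).1
  exact (Real.exp_lt_exp.1 h2).le

lemma HasRate.nonneg {L : ℕ → ℕ} {R : ℝ} (hL : HasRate L R) : 0 ≤ R :=
  ge_of_tendsto' hL.2 fun n =>
    div_nonneg (Real.log_nonneg (by exact_mod_cast hL.1 n)) n.cast_nonneg

/-- The additive constant makes room for the factor 1/2 in the soft-covering threshold. -/
lemma HasRate.log_ge {L : ℕ → ℕ} {R : ℝ} (hL : HasRate L R) {r c : ℝ} (hr : r < R) :
    ∀ᶠ n : ℕ in atTop, n * r + c ≤ Real.log (L n) := by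
  have h1 : Tendsto (fun n : ℕ => Real.log (L n) / n - c / n) atTop (𝓝 (R - 0)) :=
    hL.2.sub (tendsto_const_nhds.div_atTop tendsto_natCast_atTop_atTop)
  rw [sub_zero] at h1
  filter_upwards [h1.eventually (lt_mem_nhds hr), eventually_gt_atTop 0] with n h2 h3
  have h3' : (0 : ℝ) < n := Nat.cast_pos.2 h3
  rw [← sub_div, lt_div_iff₀ h3'] at h2
  linarith

lemma HasRate.le_exp {L : ℕ → ℕ} {R : ℝ} (hL : HasRate L R) {r : ℝ} (hr : R < r) :
    ∀ᶠ n : ℕ in atTop, (L n : ℝ≥0∞) ≤ ENNReal.ofReal (Real.exp (n * r)) := by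
  filter_upwards [hL.2.eventually (gt_mem_nhds hr), eventually_gt_atTop 0] with n h2 h3
  have h3' : (0 : ℝ) < n := Nat.cast_pos.2 h3
  have hLpos : (0 : ℝ) < L n := by exact_mod_cast hL.1 n
  rw [div_lt_iff₀ h3'] at h2
  rw [← ENNReal.ofReal_natCast]
  refine ENNReal.ofReal_le_ofReal ?_
  rw [← Real.exp_log hLpos]
  exact Real.exp_le_exp.2 (by linarith)

lemma tendsto_ofReal_exp_neg {c : ℝ} (hc : c < 0) :
    Tendsto (fun n : ℕ => ENNReal.ofReal (Real.exp (n * c))) atTop (𝓝 0) := by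
  rw [← ENNReal.ofReal_zero]
  refine (ENNReal.continuous_ofReal.tendsto _).comp (Real.tendsto_exp_atBot.comp ?_)
  exact tendsto_natCast_atTop_atTop.atTop_mul_const_of_neg hc

variable {U X : Type*} [MeasurableSpace U] [MeasurableSpace X]

/-- Countable generation provides a version of the densities that is jointly measurable in input and
output, as the soft-covering bound requires. -/
lemma compProd_eq_withDensity [MeasurableSpace.CountablyGenerated X] (Q : Measure U)
    [IsProbabilityMeasure Q] (κ : Kernel U X) [IsMarkovKernel κ] (π : Measure X)
    [IsProbabilityMeasure π] (hac : Q ⊗ₘ κ ≪ Q.prod π) :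
    ∃ F : U → X → ℝ≥0∞, Measurable (Function.uncurry F) ∧
      (∀ᵐ u ∂Q, κ u = π.withDensity (F u)) ∧
      Q ⊗ₘ κ = (Q.prod π).withDensity (Function.uncurry F) ∧
      κ ∘ₘ Q = π.withDensity fun x => ∫⁻ u, F u x ∂Q := by
  set F : U → X → ℝ≥0∞ := fun u x => Kernel.rnDeriv κ (Kernel.const U π) u x with hF
  have hFm : Measurable (Function.uncurry F) := Kernel.measurable_rnDeriv κ (Kernel.const U π)
  rw [← Measure.compProd_const] at hac
  have hκ : ∀ᵐ u ∂Q, κ u = π.withDensity (F u) := by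
    filter_upwards [hac.kernel_of_compProd] with u hu
    have := Kernel.withDensity_rnDeriv_eq hu
    rw [Kernel.withDensity_apply _ (Kernel.measurable_rnDeriv _ _), Kernel.const_apply] at this
    exact this.symm
  refine ⟨F, hFm, hκ, ?_, ?_⟩
  · ext s hs
    rw [Measure.compProd_apply hs, withDensity_apply _ hs, ← lintegral_indicator hs,
      lintegral_prod _ (hFm.indicator hs).aemeasurable]
    refine lintegral_congr_ae ?_
    filter_upwards [hκ] with u hu
    rw [hu, withDensity_apply _ (measurable_prodMk_left hs),
      ← lintegral_indicator (measurable_prodMk_left hs)]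
    rfl
  · ext s hs
    rw [Measure.bind_apply hs κ.aemeasurable, withDensity_apply _ hs,
      lintegral_lintegral_swap (f := fun x u => F u x)
        (hFm.comp measurable_swap).aemeasurable]
    refine lintegral_congr_ae ?_
    filter_upwards [hκ] with u hu
    rw [hu, withDensity_apply _ hs]

/-- Random codebooks of rate above the threshold have vanishing excess information. -/
theorem tendsto_expectedExcessInfo_zero [MeasurableSpace.CountablyGenerated X] (Q : Measure U)
    [IsProbabilityMeasure Q] (κ : Kernel U X) [IsMarkovKernel κ] (π : Measure X)
    [IsProbabilityMeasure π] {E R : ℝ} {L : ℕ → ℕ} (hL : HasRate L R)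
    (hD : klDiv (κ ∘ₘ Q) π < ENNReal.ofReal E)
    (hDI : klDiv (κ ∘ₘ Q) π + mutualInfo Q κ < ENNReal.ofReal (E + R)) :
    Tendsto (fun n => expectedExcessInfo Q κ π (expThreshold E n) (L n) n) atTop (𝓝 0) := by
  have hDtop : klDiv (κ ∘ₘ Q) π ≠ ∞ := hD.ne_top
  rw [← klDiv_compProd_prod Q κ π hDtop] at hDI
  obtain ⟨hacX, hintX⟩ := klDiv_ne_top_iff.1 hDtop
  obtain ⟨hacP, hintP⟩ := klDiv_ne_top_iff.1 hDI.ne_top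
  obtain ⟨F, hF, hκ, hP, hX⟩ := compProd_eq_withDensity Q κ π hacP
  have hgm : Measurable fun x => ∫⁻ u, F u x ∂Q := hF.lintegral_prod_left'
  have hDr : ∫ x, llr (κ ∘ₘ Q) π x ∂(κ ∘ₘ Q) < E := by
    rw [← toReal_klDiv_of_measure_eq hacX (by simp)]
    exact (ENNReal.lt_ofReal_iff_toReal_lt hDtop).1 hD
  have hDIr : ∫ p, llr (Q ⊗ₘ κ) (Q.prod π) p ∂(Q ⊗ₘ κ) < E + R := by
    rw [← toReal_klDiv_of_measure_eq hacP (by simp)]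
    exact (ENNReal.lt_ofReal_iff_toReal_lt hDI.ne_top).1 hDI
  -- `b` in (D, E) sets the truncation exp(nb) of the output density; `a` in (D + I, E + R) is the
  -- exponent allowed to a codeword's own density.
  obtain ⟨b, hb1, hb2⟩ := exists_between hDr
  obtain ⟨a, ha1, ha2⟩ := exists_between hDIr
  have hFn : ∀ n, Measurable (Function.uncurry
      fun (u : Fin n → U) (x : Fin n → X) => ∏ i, F (u i) (x i)) := fun n =>
    Finset.measurable_prod _ fun i _ => hF.comp
      (f := fun p : (Fin n → U) × (Fin n → X) => (p.1 i, p.2 i)) (by fun_prop)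
  have hWn : ∀ n, ∀ᵐ u ∂(iidLaw n Q), blockKernel κ n u
      = (iidLaw n π).withDensity fun x => ∏ i, F (u i) (x i) := by
    intro n
    have : ∀ᵐ u ∂(iidLaw n Q), ∀ i, κ (u i) = π.withDensity (F (u i)) :=
      ae_all_iff.2 fun i =>
        (measurePreserving_eval (fun _ : Fin n => Q) i).quasiMeasurePreserving.ae hκ
    filter_upwards [this] with u hu
    exact iidLaw_withDensity π _ (fun i => hF.comp measurable_prodMk_left) hu
  have hγ0 : ∀ n, expThreshold E n ≠ 0 := fun n => by simp [expThreshold, Real.exp_pos]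
  have hγt : ∀ n, expThreshold E n ≠ ∞ := fun n => ENNReal.ofReal_ne_top
  have hbound := fun n => lintegral_excessInfo_le (hL.1 n) (iidLaw n Q) (blockKernel κ n)
    (iidLaw n π) (hFn n) (hWn n) (hγ0 n) (hγt n) (ENNReal.ofReal (Real.exp (n * b)))
  have h1 : Tendsto (fun n : ℕ => (iidLaw n Q ⊗ₘ blockKernel κ n)
      {p | expThreshold E n * L n / 2 < ∏ i, F (p.1 i) (p.2 i)}) atTop (𝓝 0) := by
    have hT : ∀ᶠ n : ℕ in atTop,
        ENNReal.ofReal (Real.exp (n * a)) ≤ expThreshold E n * L n / 2 := by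
      filter_upwards [hL.log_ge (r := a - E) (c := Real.log 2) (by linarith)] with n hn
      have hLpos : (0 : ℝ) < L n := by exact_mod_cast hL.1 n
      have : expThreshold E n * L n / 2 = ENNReal.ofReal (Real.exp (n * E) * L n / 2) := by
        rw [ENNReal.ofReal_div_of_pos two_pos, ENNReal.ofReal_mul (Real.exp_pos _).le,
          ENNReal.ofReal_natCast, ENNReal.ofReal_ofNat, expThreshold]
      rw [this]
      refine ENNReal.ofReal_le_ofReal ?_
      rw [← Real.exp_log hLpos, ← Real.exp_add, ← Real.exp_log (two_pos : (0 : ℝ) < 2),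
        ← Real.exp_sub]
      refine Real.exp_le_exp.2 ?_
      linarith
    refine (tendsto_iidLaw_density_gt hF hP hintP ha1 hT).congr fun n => ?_
    have hm : MeasurableSet {p : (Fin n → U) × (Fin n → X) |
        expThreshold E n * L n / 2 < ∏ i, F (p.1 i) (p.2 i)} :=
      measurableSet_lt measurable_const (hFn n)
    rw [map_iidLaw_compProd, Measure.map_apply (MeasurableEquiv.measurable _) hm]
    rfl
  have h2 : Tendsto (fun n : ℕ => (blockKernel κ n ∘ₘ iidLaw n Q)
      {x | ENNReal.ofReal (Real.exp (n * b)) < ∫⁻ u, ∏ i, F (u i) (x i) ∂(iidLaw n Q)})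
      atTop (𝓝 0) := by
    refine (tendsto_iidLaw_density_gt hgm hX hintX hb1
      (T := fun n => ENNReal.ofReal (Real.exp (n * b)))
      (Eventually.of_forall fun _ => le_rfl)).congr fun n => ?_
    rw [comp_blockKernel]
    congr 1
    ext x
    have := lintegral_pi_prod (fun _ : Fin n => Q) (f := fun i u => F u (x i))
      fun i => hF.comp measurable_prodMk_right
    rw [← iidLaw] at this
    simp only [Set.mem_ofPred_eq, this]
  have h3 : Tendsto (fun n : ℕ => 2 * ENNReal.ofReal (Real.exp (n * b)) / expThreshold E n)
      atTop (𝓝 0) := by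
    have := ENNReal.Tendsto.const_mul (a := 2)
      (tendsto_ofReal_exp_neg (c := b - E) (by linarith)) (Or.inr (by simp))
    rw [mul_zero] at this
    refine this.congr fun n => ?_
    rw [mul_sub, Real.exp_sub, ENNReal.ofReal_div_of_pos (Real.exp_pos _), mul_div_assoc]
    rfl
  have h4 := (h1.add h2).add h3
  simp only [add_zero] at h4
  -- `hbound` applies because `outputLaw κ c` unfolds to `mixOutput (blockKernel κ n) c`.
  exact tendsto_of_tendsto_of_tendsto_of_le_of_le tendsto_const_nhds h4 (fun _ => zero_le) hbound

lemma expectedEGamma_le_expectedExcessInfo (Q : Measure U) (κ : Kernel U X) (π : Measure X)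
    (γ : ℝ≥0∞) (L n : ℕ) : expectedEGamma Q κ π γ L n ≤ expectedExcessInfo Q κ π γ L n :=
  lintegral_mono fun _ => eGamma_le_excessInfo _ _ _

theorem tendsto_expectedEGamma_zero [MeasurableSpace.CountablyGenerated X] (Q : Measure U)
    [IsProbabilityMeasure Q] (κ : Kernel U X) [IsMarkovKernel κ] (π : Measure X)
    [IsProbabilityMeasure π] {E R : ℝ} {L : ℕ → ℕ} (hL : HasRate L R)
    (hD : klDiv (κ ∘ₘ Q) π < ENNReal.ofReal E)
    (hDI : klDiv (κ ∘ₘ Q) π + mutualInfo Q κ < ENNReal.ofReal (E + R)) :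
    Tendsto (fun n => expectedEGamma Q κ π (expThreshold E n) (L n) n) atTop (𝓝 0) :=
  tendsto_of_tendsto_of_tendsto_of_le_of_le tendsto_const_nhds
    (tendsto_expectedExcessInfo_zero Q κ π hL hD hDI) (fun _ => zero_le)
    fun _ => expectedEGamma_le_expectedExcessInfo _ _ _ _ _ _

end Achievability

/-! ### Converse for random codebooks. -/

section Converse

variable {U X : Type*} [MeasurableSpace U] [MeasurableSpace X]

lemma expectedExcessInfo_le_one (Q : Measure U) [IsProbabilityMeasure Q] (κ : Kernel U X)
    [IsMarkovKernel κ] (π : Measure X) (γ : ℝ≥0∞) {L : ℕ} (hL : 1 ≤ L) (n : ℕ) :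
    expectedExcessInfo Q κ π γ L n ≤ 1 := by
  have : IsProbabilityMeasure (codebookLaw L n Q) := by unfold codebookLaw; infer_instance
  calc _ ≤ ∫⁻ _, 1 ∂(codebookLaw L n Q) := lintegral_mono fun c => by
        have : IsProbabilityMeasure (outputLaw κ c) :=
          isProbabilityMeasure_mixOutput (blockKernel κ n) hL c
        exact excessInfo_le_one _ _ _
    _ = 1 := by simp

/-- A bounded test function with mean above `a` detects its law on `n`-fold products. -/
lemma tendsto_iidLaw_test {α : Type*} [MeasurableSpace α] (μ : Measure α)
    [IsProbabilityMeasure μ] {h : α → ℝ} (hm : Measurable h) {M : ℝ} (hM : ∀ x, |h x| ≤ M)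
    {a : ℝ} (ha : a < ∫ x, h x ∂μ) :
    Tendsto (fun n : ℕ => iidLaw n μ {z | n * a ≤ ∑ i, h (z i)}) atTop (𝓝 1) := by
  have hmeas : ∀ n : ℕ, MeasurableSet {z : Fin n → α | n * a ≤ ∑ i, h (z i)} := fun n =>
    measurableSet_le measurable_const
      (Finset.measurable_sum _ fun i _ => hm.comp (measurable_pi_apply i))
  have hc : Tendsto (fun n : ℕ => iidLaw n μ {z | n * a ≤ ∑ i, h (z i)}ᶜ) atTop (𝓝 0) := by
    have h1 := tendsto_iidLaw_sum_ge μ (h := fun x => - h x) (a := -a) hm.neg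
      (integrable_of_abs_le hm hM).neg (by rw [integral_neg]; linarith)
    refine tendsto_of_tendsto_of_tendsto_of_le_of_le tendsto_const_nhds h1
      (fun _ => zero_le) fun n => measure_mono fun z hz => ?_
    have hz' : ¬ (n * a ≤ ∑ i, h (z i)) := hz
    change (n : ℝ) * -a ≤ ∑ i, - h (z i)
    rw [Finset.sum_neg_distrib]
    linarith
  have h2 := ENNReal.Tendsto.sub (tendsto_const_nhds (x := (1 : ℝ≥0∞)) (f := atTop)) hc
    (Or.inl (by simp))
  rw [tsub_zero] at h2
  refine h2.congr fun n => ?_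
  rw [prob_compl_eq_one_sub (hmeas n), ENNReal.sub_sub_cancel (by simp) prob_le_one]

/-- Random codebooks below the threshold: the output distribution stays far from `π^{⊗n}`. -/
theorem tendsto_expectedEGamma_one (Q : Measure U)
    [IsProbabilityMeasure Q] (κ : Kernel U X) [IsMarkovKernel κ] (π : Measure X)
    [IsProbabilityMeasure π] {E R : ℝ} (hE : 0 ≤ E) {L : ℕ → ℕ} (hL : HasRate L R)
    (h : ENNReal.ofReal E < klDiv (κ ∘ₘ Q) π + (mutualInfo Q κ - ENNReal.ofReal R)) :
    Tendsto (fun n => expectedEGamma Q κ π (expThreshold E n) (L n) n) atTop (𝓝 1) := by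
  have hle : ∀ n, expectedEGamma Q κ π (expThreshold E n) (L n) n ≤ 1 := fun n =>
    (expectedEGamma_le_expectedExcessInfo _ _ _ _ _ _).trans
      (expectedExcessInfo_le_one Q κ π _ (hL.1 n) n)
  have hγt : ∀ n, expThreshold E n ≠ ∞ := fun n => ENNReal.ofReal_ne_top
  -- If E < D, a test of the output alone works, whatever the number of codewords. Otherwise the
  -- excess must come from the pair divergence D + I > E + R.
  by_cases hED : ENNReal.ofReal E < klDiv (κ ∘ₘ Q) π
  · obtain ⟨f, M, hfm, hfM, hf1, hf2⟩ := exists_test_of_lt_klDiv _ _ hED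
    obtain ⟨a, ha1, ha2⟩ := exists_between hf2
    have hA : ∀ n : ℕ, MeasurableSet {x : Fin n → X | n * a ≤ ∑ i, f (x i)} := fun n =>
      measurableSet_le measurable_const
        (Finset.measurable_sum _ fun i _ => hfm.comp (measurable_pi_apply i))
    have hlow := fun n => comp_sub_le_lintegral_eGamma (hL.1 n) (iidLaw n Q) (blockKernel κ n)
      (iidLaw n π) (hγt n) (hA n)
    have h1 := tendsto_iidLaw_test (κ ∘ₘ Q) hfm hfM ha2
    have h2 : Tendsto (fun n : ℕ => expThreshold E n *
        iidLaw n π {x : Fin n → X | n * a ≤ ∑ i, f (x i)}) atTop (𝓝 0) := by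
      refine tendsto_of_tendsto_of_tendsto_of_le_of_le tendsto_const_nhds
        (tendsto_ofReal_exp_neg (c := E - a) (by linarith)) (fun _ => zero_le) fun n => ?_
      calc _ ≤ expThreshold E n * ENNReal.ofReal (Real.exp (-(n * a))) := by
            gcongr
            exact pi_sum_ge_le (fun _ : Fin n => π) (fun _ => hfm) (fun _ => hfM)
              (fun _ => hf1) a
        _ = _ := by
            rw [expThreshold, ← ENNReal.ofReal_mul (Real.exp_pos _).le, ← Real.exp_add]
            congr 2
            ring
    have h3 := ENNReal.Tendsto.sub h1 h2 (Or.inl (by simp))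
    rw [tsub_zero] at h3
    refine tendsto_of_tendsto_of_tendsto_of_le_of_le h3 tendsto_const_nhds (fun n => ?_) hle
    have := hlow n
    rw [comp_blockKernel] at this
    exact this
  · have hDE := not_lt.1 hED
    have hDtop : klDiv (κ ∘ₘ Q) π ≠ ∞ := ne_top_of_le_ne_top (by simp) hDE
    have hR := hL.nonneg
    have hDI : ENNReal.ofReal (E + R) < klDiv (Q ⊗ₘ κ) (Q.prod π) := by
      rw [klDiv_compProd_prod Q κ π hDtop, ENNReal.ofReal_add hE hR]
      have hIR : ENNReal.ofReal R < mutualInfo Q κ := by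
        by_contra hcon
        rw [tsub_eq_zero_of_le (not_lt.1 hcon), add_zero] at h
        exact hED h
      calc ENNReal.ofReal E + ENNReal.ofReal R
          < klDiv (κ ∘ₘ Q) π + (mutualInfo Q κ - ENNReal.ofReal R) + ENNReal.ofReal R :=
            ENNReal.add_lt_add_right (by simp) h
        _ = _ := by rw [add_assoc, tsub_add_cancel_of_le hIR.le]
    obtain ⟨f, M, hfm, hfM, hf1, hf2⟩ := exists_test_of_lt_klDiv _ _ hDI
    obtain ⟨a, ha1, ha2⟩ := exists_between hf2
    have hS : ∀ n : ℕ, MeasurableSet {p : (Fin n → U) × (Fin n → X) |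
        n * a ≤ ∑ i, f (p.1 i, p.2 i)} := fun n =>
      measurableSet_le measurable_const
        (Finset.measurable_sum _ fun i _ => hfm.comp
          (f := fun p : (Fin n → U) × (Fin n → X) => (p.1 i, p.2 i)) (by fun_prop))
    have hlow := fun n => compProd_sub_le_lintegral_eGamma (hL.1 n) (iidLaw n Q)
      (blockKernel κ n) (iidLaw n π) (hγt n) (hS n)
    have hpre : ∀ n : ℕ, MeasurableEquiv.arrowProdEquivProdArrow U X (Fin n) ⁻¹'
        {p : (Fin n → U) × (Fin n → X) | n * a ≤ ∑ i, f (p.1 i, p.2 i)}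
        = {z | n * a ≤ ∑ i, f (z i)} := fun n => rfl
    have h1 := tendsto_iidLaw_test (Q ⊗ₘ κ) hfm hfM ha2
    have h2 : Tendsto (fun n : ℕ => expThreshold E n * (L n *
        iidLaw n (Q.prod π) {z | n * a ≤ ∑ i, f (z i)})) atTop (𝓝 0) := by
      obtain ⟨r, hr1, hr2⟩ := exists_between (show R < a - E by linarith)
      refine tendsto_of_tendsto_of_tendsto_of_le_of_le' tendsto_const_nhds
        (tendsto_ofReal_exp_neg (c := E + r - a) (by linarith))
        (Eventually.of_forall fun _ => zero_le) ?_
      filter_upwards [hL.le_exp hr1] with n hn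
      calc _ ≤ expThreshold E n * (ENNReal.ofReal (Real.exp (n * r)) *
              ENNReal.ofReal (Real.exp (-(n * a)))) := by
            gcongr
            exact pi_sum_ge_le (fun _ : Fin n => Q.prod π) (fun _ => hfm) (fun _ => hfM)
              (fun _ => hf1) a
        _ = _ := by
            rw [expThreshold, ← ENNReal.ofReal_mul (Real.exp_pos _).le, ← Real.exp_add,
              ← ENNReal.ofReal_mul (Real.exp_pos _).le, ← Real.exp_add]
            congr 2
            ring
    have h3 := ENNReal.Tendsto.sub h1 h2 (Or.inl (by simp))
    rw [tsub_zero] at h3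
    refine tendsto_of_tendsto_of_tendsto_of_le_of_le h3 tendsto_const_nhds (fun n => ?_) hle
    have := hlow n
    rw [map_iidLaw_compProd, map_iidLaw_prod, Measure.map_apply (MeasurableEquiv.measurable _)
      (hS n), Measure.map_apply (MeasurableEquiv.measurable _) (hS n), hpre] at this
    exact this

theorem tendsto_expectedExcessInfo_one (Q : Measure U)
    [IsProbabilityMeasure Q] (κ : Kernel U X) [IsMarkovKernel κ] (π : Measure X)
    [IsProbabilityMeasure π] {E R : ℝ} (hE : 0 ≤ E) {L : ℕ → ℕ} (hL : HasRate L R)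
    (h : ENNReal.ofReal E < klDiv (κ ∘ₘ Q) π + (mutualInfo Q κ - ENNReal.ofReal R)) :
    Tendsto (fun n => expectedExcessInfo Q κ π (expThreshold E n) (L n) n) atTop (𝓝 1) :=
  tendsto_of_tendsto_of_tendsto_of_le_of_le (tendsto_expectedEGamma_one Q κ π hE hL h)
    tendsto_const_nhds (fun _ => expectedEGamma_le_expectedExcessInfo _ _ _ _ _ _)
    fun n => expectedExcessInfo_le_one Q κ π _ (hL.1 n) n

end Converse


/-! ### Sufficiency of the single-letter rate. -/

section SingleLetter

variable {U X : Type*} [MeasurableSpace U] [MeasurableSpace X]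

lemma comp_mix (Q₀ Q₁ : Measure U) (κ : Kernel U X) (s t : ℝ≥0∞) :
    κ ∘ₘ (s • Q₀ + t • Q₁) = s • (κ ∘ₘ Q₀) + t • (κ ∘ₘ Q₁) := by
  ext A hA
  simp [Measure.bind_apply hA κ.aemeasurable]

lemma compProd_mix (Q₀ Q₁ : Measure U) [IsProbabilityMeasure Q₀] [IsProbabilityMeasure Q₁]
    (κ : Kernel U X) [IsMarkovKernel κ] {s t : ℝ≥0∞} [IsFiniteMeasure (s • Q₀ + t • Q₁)] :
    (s • Q₀ + t • Q₁) ⊗ₘ κ = s • (Q₀ ⊗ₘ κ) + t • (Q₁ ⊗ₘ κ) := by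
  ext A hA
  simp [Measure.compProd_apply hA]

lemma prod_mix (Q₀ Q₁ : Measure U) [IsProbabilityMeasure Q₀] [IsProbabilityMeasure Q₁]
    (π : Measure X) [IsProbabilityMeasure π] {s t : ℝ≥0∞} [IsFiniteMeasure (s • Q₀ + t • Q₁)] :
    (s • Q₀ + t • Q₁).prod π = s • Q₀.prod π + t • Q₁.prod π := by
  simp_rw [← Measure.compProd_const]
  exact compProd_mix Q₀ Q₁ (Kernel.const U π)

/-- Mixing a near-optimal input law with one that has slack in the output constraint. -/
lemma exists_input_strict (κ : Kernel U X) [IsMarkovKernel κ] (π : Measure X)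
    [IsProbabilityMeasure π] {E R : ℝ} (Q₀ Q₁ : Measure U) [IsProbabilityMeasure Q₀]
    [IsProbabilityMeasure Q₁] (h₀ : klDiv (κ ∘ₘ Q₀) π < ENNReal.ofReal E)
    (hI₀ : mutualInfo Q₀ κ ≠ ∞) (h₁ : klDiv (κ ∘ₘ Q₁) π ≤ ENNReal.ofReal E)
    (hI₁ : klDiv (κ ∘ₘ Q₁) π + mutualInfo Q₁ κ < ENNReal.ofReal (E + R)) :
    ∃ Q : Measure U, IsProbabilityMeasure Q ∧ klDiv (κ ∘ₘ Q) π < ENNReal.ofReal E ∧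
      klDiv (κ ∘ₘ Q) π + mutualInfo Q κ < ENNReal.ofReal (E + R) := by
  have hD₀ := h₀.ne_top
  have hD₁ : klDiv (κ ∘ₘ Q₁) π ≠ ∞ := ne_top_of_le_ne_top (by simp) h₁
  have hK₀ : klDiv (Q₀ ⊗ₘ κ) (Q₀.prod π) ≠ ∞ := by
    rw [klDiv_compProd_prod Q₀ κ π hD₀]
    exact ENNReal.add_ne_top.2 ⟨hD₀, hI₀⟩
  rw [← klDiv_compProd_prod Q₁ κ π hD₁] at hI₁
  have hK₁ := hI₁.ne_top
  have hE : 0 < E := ENNReal.ofReal_pos.1 (bot_lt_of_lt h₀)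
  set k₀ := (klDiv (Q₀ ⊗ₘ κ) (Q₀.prod π)).toReal
  set k₁ := (klDiv (Q₁ ⊗ₘ κ) (Q₁.prod π)).toReal with hk₁
  have hr₁ : k₁ < E + R := (ENNReal.lt_ofReal_iff_toReal_lt hK₁).1 hI₁
  have hd₀ : (klDiv (κ ∘ₘ Q₀) π).toReal < E := (ENNReal.lt_ofReal_iff_toReal_lt hD₀).1 h₀
  have hd₁ : (klDiv (κ ∘ₘ Q₁) π).toReal ≤ E := ENNReal.toReal_le_of_le_ofReal hE.le h₁
  set c := E + R - k₁ with hc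
  have hcpos : 0 < c := by linarith
  -- The weight of `Q₀` is positive, which makes the output constraint strict, yet small enough that
  -- t |k₀ - k₁| stays below the slack `c`.
  set t := c / (c + |k₀ - k₁| + 1) with ht
  have hden : 0 < c + |k₀ - k₁| + 1 := by positivity
  have ht0 : 0 < t := by positivity
  have ht1 : t < 1 := by
    rw [ht, div_lt_one hden]
    linarith [abs_nonneg (k₀ - k₁)]
  have htd : t * |k₀ - k₁| < c := by
    rw [ht, div_mul_eq_mul_div, div_lt_iff₀ hden]
    nlinarith
  have hs0 : 0 ≤ 1 - t := by linarith
  have hst : (1 - t) + t = 1 := by ring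
  have hprob := isProbabilityMeasure_mix Q₁ Q₀ hs0 ht0.le hst
  have hπ : ENNReal.ofReal (1 - t) • π + ENNReal.ofReal t • π = π := by
    rw [← add_smul, ← ENNReal.ofReal_add hs0 ht0.le, hst, ENNReal.ofReal_one, one_smul]
  have hDmix := klDiv_mix_le (κ ∘ₘ Q₁) (κ ∘ₘ Q₀) π π hs0 ht0.le hst hD₁ hD₀
  rw [hπ, ← comp_mix] at hDmix
  -- Mutual information alone is concave in the input law. The sum D + I is a divergence whose two
  -- arguments are both affine in that law, so joint convexity applies.
  have hKmix := klDiv_mix_le (Q₁ ⊗ₘ κ) (Q₀ ⊗ₘ κ) (Q₁.prod π) (Q₀.prod π) hs0 ht0.le hst hK₁ hK₀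
  rw [← compProd_mix, ← prod_mix] at hKmix
  have hDlt : klDiv (κ ∘ₘ (ENNReal.ofReal (1 - t) • Q₁ + ENNReal.ofReal t • Q₀)) π
      < ENNReal.ofReal E := by
    refine hDmix.trans_lt ((ENNReal.ofReal_lt_ofReal_iff hE).2 ?_)
    nlinarith
  refine ⟨_, hprob, hDlt, ?_⟩
  rw [← klDiv_compProd_prod _ κ π hDlt.ne_top]
  refine hKmix.trans_lt ((ENNReal.ofReal_lt_ofReal_iff ?_).2 ?_)
  · exact lt_of_le_of_lt ENNReal.toReal_nonneg hr₁
  · change (1 - t) * k₁ + t * k₀ < E + R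
    have := mul_le_mul_of_nonneg_left (le_abs_self (k₀ - k₁)) ht0.le
    nlinarith

/-- Some codebook is no worse than the average. With the slack `ε`, only monotonicity of the lower
integral is used, so the integrand need not be measurable in the codebook. -/
lemma exists_codebook_le (Q : Measure U) [IsProbabilityMeasure Q] (κ : Kernel U X)
    [IsMarkovKernel κ] (π : Measure X) (γ : ℝ≥0∞) {L : ℕ} (hL : 1 ≤ L) (n : ℕ) {ε : ℝ≥0∞}
    (hε : ε ≠ 0) :
    ∃ c : Fin L → Fin n → U,
      eGamma γ (outputLaw κ c) (iidLaw n π) ≤ expectedEGamma Q κ π γ L n + ε := by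
  by_contra! hcon
  have : IsProbabilityMeasure (codebookLaw L n Q) := by unfold codebookLaw; infer_instance
  have hfin : expectedEGamma Q κ π γ L n ≠ ∞ := ne_top_of_le_ne_top ENNReal.one_ne_top
    ((expectedEGamma_le_expectedExcessInfo _ _ _ _ _ _).trans
      (expectedExcessInfo_le_one Q κ π γ hL n))
  have h1 : expectedEGamma Q κ π γ L n + ε ≤ expectedEGamma Q κ π γ L n := by
    calc _ = ∫⁻ _, (expectedEGamma Q κ π γ L n + ε) ∂(codebookLaw L n Q) := by simp
      _ ≤ _ := lintegral_mono fun c => (hcon c).le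
  exact absurd h1 (not_le.2 (ENNReal.lt_add_right hfin hε))

theorem exists_codebooks_of_singleLetterRate_lt [MeasurableSpace.CountablyGenerated X]
    (κ : Kernel U X) [IsMarkovKernel κ] (π : Measure X) [IsProbabilityMeasure π] {E R : ℝ}
    {L : ℕ → ℕ} (hL : HasRate L R)
    (h₀ : ∃ Q₀ : ProbabilityMeasure U, klDiv (κ ∘ₘ (Q₀ : Measure U)) π < ENNReal.ofReal E ∧
      mutualInfo (Q₀ : Measure U) κ ≠ ∞)
    (hr : singleLetterRate κ π E < (R : EReal)) :
    ∃ c : (n : ℕ) → Fin (L n) → Fin n → U,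
      Tendsto (fun n => eGamma (expThreshold E n) (outputLaw κ (c n)) (iidLaw n π))
        atTop (𝓝 0) := by
  obtain ⟨Q₀, hQ₀, hI₀⟩ := h₀
  simp only [singleLetterRate, iInf_lt_iff] at hr
  obtain ⟨Q₁, hQ₁, hI₁⟩ := hr
  have hI₁' : klDiv (κ ∘ₘ (Q₁ : Measure U)) π + mutualInfo (Q₁ : Measure U) κ
      < ENNReal.ofReal (E + R) := by
    rw [EReal.sub_lt_iff (by simp) (by simp), add_comm (R : EReal), ← EReal.coe_add] at hI₁
    rw [← EReal.coe_ennreal_lt_coe_ennreal_iff, EReal.coe_ennreal_ofReal]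
    exact hI₁.trans_le (EReal.coe_le_coe_iff.2 (le_max_left _ _))
  obtain ⟨Q, hQ, hD, hDI⟩ := exists_input_strict κ π (Q₀ : Measure U) (Q₁ : Measure U)
    hQ₀ hI₀ hQ₁ hI₁'
  have hε : ∀ n : ℕ, ((n : ℝ≥0∞) + 1)⁻¹ ≠ 0 := fun n => by simp
  choose c hc using fun n => exists_codebook_le Q κ π (expThreshold E n) (hL.1 n) n (hε n)
  refine ⟨c, tendsto_of_tendsto_of_tendsto_of_le_of_le tendsto_const_nhds ?_
    (fun _ => zero_le) hc⟩
  have h1 := tendsto_expectedEGamma_zero Q κ π hL hD hDI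
  have h2 : Tendsto (fun n : ℕ => ((n : ℝ≥0∞) + 1)⁻¹) atTop (𝓝 0) := by
    have := (tendsto_add_atTop_iff_nat 1).2 ENNReal.tendsto_inv_nat_nhds_zero
    simpa using this
  simpa using h1.add h2

end SingleLetter

/-! ### Tests normalised for every input letter, and types of words. -/

section LetterTests

variable {U X : Type*} [MeasurableSpace X]

/-- A bounded likelihood test for the pair, normalised for every input letter, whose threshold
beats `E` (if the test ignores the input) or `E + R`. -/
structure LetterTest (U : Type*) {X : Type*} [MeasurableSpace X] (π : Measure X) (E R : ℝ) where
  /-- the statistic -/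
  f : U → X → ℝ
  /-- a bound for the statistic -/
  M : ℝ
  /-- the threshold -/
  b : ℝ
  measurable : ∀ u, Measurable (f u)
  abs_le : ∀ u x, |f u x| ≤ M
  exp_le : ∀ u, ∫ x, Real.exp (f u x) ∂π ≤ 1
  threshold : ((∀ u v, f u = f v) ∧ E < b) ∨ E + R < b

/-- The event that the test fires for some codeword. -/
def LetterTest.event {π : Measure X} {E R : ℝ} (T : LetterTest U π E R) {L n : ℕ}
    (c : Fin L → Fin n → U) : Set (Fin n → X) :=
  ⋃ l, {x | n * T.b ≤ ∑ i, T.f (c l i) (x i)}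

lemma LetterTest.measurableSet_event {π : Measure X} {E R : ℝ} (T : LetterTest U π E R)
    {L n : ℕ} (c : Fin L → Fin n → U) : MeasurableSet (T.event c) :=
  MeasurableSet.iUnion fun _ => measurableSet_le measurable_const
    (Finset.measurable_sum _ fun i _ => (T.measurable _).comp (measurable_pi_apply i))

/-- A test that ignores the input has the same event for all codewords, so b > E suffices; otherwise
the union bound costs the rate `R`. -/
lemma LetterTest.tendsto_event {π : Measure X} [IsProbabilityMeasure π] {E R : ℝ}
    (T : LetterTest U π E R) {L : ℕ → ℕ} (hL : HasRate L R)
    (c : (n : ℕ) → Fin (L n) → Fin n → U) :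
    Tendsto (fun n => expThreshold E n * iidLaw n π (T.event (c n))) atTop (𝓝 0) := by
  have hone : ∀ n (l : Fin (L n)), iidLaw n π {x | n * T.b ≤ ∑ i, T.f (c n l i) (x i)}
      ≤ ENNReal.ofReal (Real.exp (-(n * T.b))) := fun n l =>
    pi_sum_ge_le (fun _ : Fin n => π) (h := fun i => T.f (c n l i)) (fun i => T.measurable _)
      (fun i => T.abs_le _) (fun i => T.exp_le _) T.b
  rcases T.threshold with ⟨hconst, hb⟩ | hb
  · refine tendsto_of_tendsto_of_tendsto_of_le_of_le tendsto_const_nhds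
      (tendsto_ofReal_exp_neg (c := E - T.b) (by linarith)) (fun _ => zero_le) fun n => ?_
    have hev : T.event (c n) ⊆ {x | n * T.b ≤ ∑ i, T.f (c n ⟨0, hL.1 n⟩ i) (x i)} := by
      refine Set.iUnion_subset fun l x hx => ?_
      have hx' : n * T.b ≤ ∑ i, T.f (c n l i) (x i) := hx
      refine hx'.trans (le_of_eq (Finset.sum_congr rfl fun i _ => ?_))
      rw [hconst (c n l i)]
    calc _ ≤ expThreshold E n * ENNReal.ofReal (Real.exp (-(n * T.b))) := by
          gcongr
          exact (measure_mono hev).trans (hone n _)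
      _ = _ := by
          rw [expThreshold, ← ENNReal.ofReal_mul (Real.exp_pos _).le, ← Real.exp_add]
          congr 2
          ring
  · obtain ⟨r, hr1, hr2⟩ := exists_between (show R < T.b - E by linarith)
    refine tendsto_of_tendsto_of_tendsto_of_le_of_le' tendsto_const_nhds
      (tendsto_ofReal_exp_neg (c := E + r - T.b) (by linarith))
      (Eventually.of_forall fun _ => zero_le) ?_
    filter_upwards [hL.le_exp hr1] with n hn
    calc _ ≤ expThreshold E n * (ENNReal.ofReal (Real.exp (n * r)) *
            ENNReal.ofReal (Real.exp (-(n * T.b)))) := by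
          gcongr
          refine (measure_iUnion_fintype_le _ _).trans
            ((Finset.sum_le_sum fun l _ => hone n l).trans ?_)
          rw [Finset.sum_const, Finset.card_univ, Fintype.card_fin, nsmul_eq_mul]
          gcongr
      _ = _ := by
          rw [expThreshold, ← ENNReal.ofReal_mul (Real.exp_pos _).le, ← Real.exp_add,
            ← ENNReal.ofReal_mul (Real.exp_pos _).le, ← Real.exp_add]
          congr 2
          ring

/-- The empirical law of a word. -/
def wordType [DecidableEq U] {n : ℕ} (w : Fin n → U) (u : U) : ℝ :=
  (Finset.univ.filter fun i => w i = u).card / n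

/-- The mean of an additive test statistic given a codeword depends only on the type, linearly. -/
lemma sum_wordType_mul [Fintype U] [DecidableEq U] {n : ℕ} (hn : 0 < n) (w : Fin n → U)
    (m : U → ℝ) : n * ∑ u, wordType w u * m u = ∑ i, m (w i) := by
  have hn' : (n : ℝ) ≠ 0 := by exact_mod_cast hn.ne'
  rw [← Finset.sum_fiberwise Finset.univ w fun i => m (w i), Finset.mul_sum]
  refine Finset.sum_congr rfl fun u _ => ?_
  rw [Finset.sum_congr rfl (g := fun _ => m u) fun i hi => by rw [(Finset.mem_filter.1 hi).2],
    Finset.sum_const, nsmul_eq_mul, wordType]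
  field_simp

lemma wordType_mem_stdSimplex [Fintype U] [DecidableEq U] {n : ℕ} (hn : 0 < n) (w : Fin n → U) :
    wordType w ∈ stdSimplex ℝ U := by
  refine ⟨fun u => by unfold wordType; positivity, ?_⟩
  have hn' : (n : ℝ) ≠ 0 := by exact_mod_cast hn.ne'
  have := sum_wordType_mul hn w fun _ => 1
  simp only [mul_one, Finset.sum_const, Finset.card_univ, Fintype.card_fin, nsmul_eq_mul] at this
  exact mul_left_cancel₀ hn' (by rw [this, mul_one])

end LetterTests

/-! ### Necessity of the single-letter rate for finite alphabets. -/

section FiniteConverse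

variable {U X : Type*} [MeasurableSpace U] [MeasurableSpace X]

/-- The law on a finite alphabet with point masses `q`. -/
def pointMassLaw [Fintype U] (q : U → ℝ) : Measure U :=
  ∑ u, ENNReal.ofReal (q u) • Measure.dirac u

lemma isProbabilityMeasure_pointMassLaw [Fintype U] {q : U → ℝ} (hq : q ∈ stdSimplex ℝ U) :
    IsProbabilityMeasure (pointMassLaw q) := by
  constructor
  simp [pointMassLaw, Measure.finsetSum_apply, ← ENNReal.ofReal_sum_of_nonneg fun u _ => hq.1 u,
    hq.2]

lemma integral_pointMassLaw [Fintype U] [MeasurableSingletonClass U] {q : U → ℝ}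
    (hq : q ∈ stdSimplex ℝ U) (f : U → ℝ) :
    ∫ u, f u ∂(pointMassLaw q) = ∑ u, q u * f u := by
  rw [pointMassLaw, integral_finsetSum_measure fun u _ =>
    (integrable_dirac (by simp)).smul_measure ENNReal.ofReal_ne_top]
  refine Finset.sum_congr rfl fun u _ => ?_
  rw [integral_smul_measure, integral_dirac, ENNReal.toReal_ofReal (hq.1 u), smul_eq_mul]

lemma integral_pointMassLaw_compProd [Fintype U] [MeasurableSingletonClass U] {q : U → ℝ}
    (hq : q ∈ stdSimplex ℝ U) (κ : Kernel U X) [IsMarkovKernel κ] {f : U × X → ℝ}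
    (hf : Measurable f) {M : ℝ} (hM : ∀ p, |f p| ≤ M) :
    ∫ p, f p ∂(pointMassLaw q ⊗ₘ κ) = ∑ u, q u * ∫ x, f (u, x) ∂(κ u) := by
  have := isProbabilityMeasure_pointMassLaw hq
  rw [Measure.integral_compProd (integrable_of_abs_le hf hM), integral_pointMassLaw hq]

/-- Under `H` every input law violates D ≤ E or has D + I > E + R; the Donsker–Varadhan test is
taken on the output or on the pair accordingly. -/
lemma exists_letterTest [Fintype U] [DiscreteMeasurableSpace U] (κ : Kernel U X)
    [IsMarkovKernel κ] (π : Measure X) [IsProbabilityMeasure π] {E R : ℝ}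
    (H : ∀ Q : Measure U, IsProbabilityMeasure Q → klDiv (κ ∘ₘ Q) π ≤ ENNReal.ofReal E →
      ENNReal.ofReal (E + R) < klDiv (κ ∘ₘ Q) π + mutualInfo Q κ)
    {q : U → ℝ} (hq : q ∈ stdSimplex ℝ U) :
    ∃ T : LetterTest U π E R, T.b < ∑ u, q u * ∫ x, T.f u x ∂(κ u) := by
  have hprob := isProbabilityMeasure_pointMassLaw hq
  by_cases hD : klDiv (κ ∘ₘ pointMassLaw q) π ≤ ENNReal.ofReal E
  · have hDI := H _ hprob hD
    rw [← klDiv_compProd_prod _ κ π (ne_top_of_le_ne_top (by simp) hD)] at hDI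
    obtain ⟨f, M, hfm, hfM, hf1, hf2⟩ := exists_test_of_lt_klDiv _ _ hDI
    have hem : Measurable fun p => Real.exp (f p) := hfm.exp
    rw [← Measure.compProd_const, integral_pointMassLaw_compProd hq _ hem (M := Real.exp M)
      fun p => by
        rw [abs_of_pos (Real.exp_pos _)]
        exact Real.exp_le_exp.2 ((le_abs_self _).trans (hfM p))] at hf1
    rw [integral_pointMassLaw_compProd hq κ hfm hfM] at hf2
    simp only [Kernel.const_apply] at hf1
    have hfu : ∀ u, Measurable fun x => f (u, x) := fun u => hfm.comp measurable_prodMk_left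
    -- The test is normalised only on average over `q`, but a fixed codeword needs it letter by
    -- letter. Subtracting `log (Z u)` does not lower the mean, since log Z ≤ Z - 1 and ∑ q Z ≤ 1.
    set Z : U → ℝ := fun u => ∫ x, Real.exp (f (u, x)) ∂π with hZ
    have hZpos : ∀ u, 0 < Z u := fun u =>
      integral_exp_pos (integrable_exp_of_abs_le (hfu u) fun x => hfM (u, x))
    have hlin : ∑ u, q u * ∫ x, f (u, x) ∂(κ u)
        ≤ ∑ u, q u * ∫ x, (f (u, x) - Real.log (Z u)) ∂(κ u) := by
      have h1 : ∀ u, q u * ∫ x, f (u, x) ∂(κ u)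
          ≤ q u * ∫ x, (f (u, x) - Real.log (Z u)) ∂(κ u) + (q u * Z u - q u) := by
        intro u
        rw [integral_sub (integrable_of_abs_le (hfu u) fun x => hfM (u, x))
          (integrable_const _)]
        have h2 := mul_le_mul_of_nonneg_left (Real.log_le_sub_one_of_pos (hZpos u)) (hq.1 u)
        simp only [integral_const, probReal_univ, smul_eq_mul, one_mul]
        linarith
      have h3 := Finset.sum_le_sum fun u (_ : u ∈ Finset.univ) => h1 u
      rw [Finset.sum_add_distrib, Finset.sum_sub_distrib, hq.2] at h3
      linarith
    obtain ⟨b, hb1, hb2⟩ := exists_between (hf2.trans_le hlin)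
    refine ⟨⟨fun u x => f (u, x) - Real.log (Z u), M + ∑ u, |Real.log (Z u)|, b,
      fun u => (hfu u).sub_const _, fun u x => (abs_sub _ _).trans (add_le_add (hfM _) ?_),
      fun u => ?_, Or.inr hb1⟩, hb2⟩
    · exact Finset.single_le_sum (f := fun u => |Real.log (Z u)|) (fun u _ => abs_nonneg _)
        (Finset.mem_univ u)
    · simp_rw [Real.exp_sub, Real.exp_log (hZpos u)]
      rw [integral_div, div_self (hZpos u).ne']
  · obtain ⟨f, M, hfm, hfM, hf1, hf2⟩ := exists_test_of_lt_klDiv _ _ (not_le.1 hD)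
    rw [← map_snd_compProd, integral_map measurable_snd.aemeasurable hfm.aestronglyMeasurable,
      integral_pointMassLaw_compProd hq κ (f := fun p => f p.2) (hfm.comp measurable_snd)
        fun p => hfM p.2] at hf2
    obtain ⟨b, hb1, hb2⟩ := exists_between hf2
    exact ⟨⟨fun _ => f, M, b, fun _ => hfm, fun _ => hfM, fun _ => hf1,
      Or.inl ⟨fun _ _ => rfl, hb1⟩⟩, hb2⟩

theorem singleLetterRate_le_of_tendsto [Fintype U] [DiscreteMeasurableSpace U] (κ : Kernel U X)
    [IsMarkovKernel κ] (π : Measure X) [IsProbabilityMeasure π] {E R : ℝ} (hE : 0 ≤ E)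
    {L : ℕ → ℕ} (hL : HasRate L R) (c : (n : ℕ) → Fin (L n) → Fin n → U)
    (hc : Tendsto (fun n => eGamma (expThreshold E n) (outputLaw κ (c n)) (iidLaw n π))
      atTop (𝓝 0)) : singleLetterRate κ π E ≤ (R : EReal) := by
  classical
  by_contra! hlt
  have H : ∀ Q : Measure U, IsProbabilityMeasure Q → klDiv (κ ∘ₘ Q) π ≤ ENNReal.ofReal E →
      ENNReal.ofReal (E + R) < klDiv (κ ∘ₘ Q) π + mutualInfo Q κ := by
    intro Q hQ hD
    have h1 : (R : EReal) < ((klDiv (κ ∘ₘ Q) π + mutualInfo Q κ : ℝ≥0∞) : EReal) - (E : EReal) :=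
      hlt.trans_le (iInf₂_le (⟨Q, hQ⟩ : ProbabilityMeasure U) hD)
    rw [EReal.lt_sub_iff_add_lt (by simp) (by simp), add_comm, ← EReal.coe_add] at h1
    rwa [← EReal.coe_ennreal_lt_coe_ennreal_iff, EReal.coe_ennreal_ofReal,
      max_eq_left (add_nonneg hE hL.nonneg)]
  have : Nonempty (LetterTest U π E R) :=
    ⟨⟨fun _ _ => 0, 0, E + R + 1, fun _ => measurable_const, by simp, by simp,
      Or.inr (by linarith)⟩⟩
  choose! T hT using fun (q : U → ℝ) (hq : q ∈ stdSimplex ℝ U) => exists_letterTest κ π H hq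
  -- The margin `δ` is what Chebyshev's inequality consumes; half the gap leaves the inequality
  -- strict, hence open in the type.
  choose! δ hδ using fun (q : U → ℝ) (hq : q ∈ stdSimplex ℝ U) =>
    show ∃ δ : ℝ, 0 < δ ∧ (T q).b + δ < ∑ u, q u * ∫ x, (T q).f u x ∂(κ u) from
      ⟨(∑ u, q u * ∫ x, (T q).f u x ∂(κ u) - (T q).b) / 2, by linarith [hT q hq],
        by linarith [hT q hq]⟩
  obtain ⟨t, htS, htc⟩ := (isCompact_stdSimplex ℝ U).elim_nhds_subcover
    (fun q => {p : U → ℝ | (T q).b + δ q < ∑ u, p u * ∫ x, (T q).f u x ∂(κ u)}) fun q hq =>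
      (isOpen_lt continuous_const (by fun_prop)).mem_nhds (hδ q hq).2
  set A : (n : ℕ) → Set (Fin n → X) := fun n => ⋃ q ∈ t, (T q).event (c n) with hA
  have hAm : ∀ n, MeasurableSet (A n) := fun n =>
    t.measurableSet_biUnion fun q _ => (T q).measurableSet_event _
  set ε : ℕ → ℝ≥0∞ := fun n => ∑ q ∈ t, ENNReal.ofReal ((T q).M ^ 2 / (n * δ q ^ 2)) with hε
  have hε0 : Tendsto ε atTop (𝓝 0) := by
    rw [← Finset.sum_const_zero (s := t) (ι := U → ℝ) (M := ℝ≥0∞)]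
    refine tendsto_finsetSum _ fun q hq => ?_
    rw [← ENNReal.ofReal_zero]
    refine (ENNReal.continuous_ofReal.tendsto _).comp (tendsto_const_nhds.div_atTop ?_)
    exact tendsto_natCast_atTop_atTop.atTop_mul_const (pow_pos (hδ q (htS q hq)).1 2)
  have hnull : Tendsto (fun n => expThreshold E n * iidLaw n π (A n)) atTop (𝓝 0) := by
    have h1 : Tendsto (fun n => ∑ q ∈ t, expThreshold E n * iidLaw n π ((T q).event (c n)))
        atTop (𝓝 0) := by
      rw [← Finset.sum_const_zero (s := t) (ι := U → ℝ) (M := ℝ≥0∞)]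
      exact tendsto_finsetSum _ fun q _ => (T q).tendsto_event hL c
    refine tendsto_of_tendsto_of_tendsto_of_le_of_le tendsto_const_nhds h1 (fun _ => zero_le)
      fun n => ?_
    rw [← Finset.mul_sum]
    dsimp only
    gcongr
    exact measure_biUnion_finset_le _ _
  -- The type of each codeword lies in one of the finitely many neighbourhoods, whose test fires
  -- with probability at least `1 - ε n`, uniformly in the codeword.
  have hword : ∀ n, 0 < n → ∀ l, 1 - ε n ≤ blockKernel κ n (c n l) (A n) := by
    intro n hn l
    have hmem := htc (wordType_mem_stdSimplex hn (c n l))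
    simp only [Set.mem_iUnion, Set.mem_ofPred_eq, exists_prop] at hmem
    obtain ⟨q, hqt, hq⟩ := hmem
    have hmean : n * ((T q).b + δ q) ≤ ∑ i, ∫ x, (T q).f (c n l i) x ∂(κ (c n l i)) := by
      rw [← sum_wordType_mul hn (c n l) fun u => ∫ x, (T q).f u x ∂(κ u)]
      gcongr
    have hcheb := pi_sum_lt_le hn (fun i => κ (c n l i)) (h := fun i => (T q).f (c n l i))
      (fun i => (T q).measurable _) (fun i => (T q).abs_le _) (hδ q (htS q hqt)).1 hmean
    have hcompl : (A n)ᶜ ⊆ {z | ∑ i, (T q).f (c n l i) (z i) < n * (T q).b} := by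
      intro z hz
      by_contra hcon
      refine hz (Set.mem_biUnion hqt (Set.mem_iUnion.2 ⟨l, ?_⟩))
      exact (not_lt.1 hcon : n * (T q).b ≤ ∑ i, (T q).f (c n l i) (z i))
    have hle : blockKernel κ n (c n l) (A n)ᶜ ≤ ε n :=
      (measure_mono hcompl).trans (hcheb.trans
        (Finset.single_le_sum (f := fun q => ENNReal.ofReal ((T q).M ^ 2 / (n * δ q ^ 2)))
          (fun _ _ => zero_le) hqt))
    rw [tsub_le_iff_right, ← measure_univ (μ := blockKernel κ n (c n l)),
      ← measure_add_measure_compl (hAm n)]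
    gcongr
  have hlow : ∀ᶠ n in atTop, 1 - ε n - expThreshold E n * iidLaw n π (A n)
      ≤ eGamma (expThreshold E n) (outputLaw κ (c n)) (iidLaw n π) := by
    filter_upwards [eventually_gt_atTop 0] with n hn
    have : IsProbabilityMeasure (outputLaw κ (c n)) :=
      isProbabilityMeasure_mixOutput (blockKernel κ n) (hL.1 n) (c n)
    refine le_trans ?_ (measure_sub_mul_le_eGamma _ _
      (γ := expThreshold E n) ENNReal.ofReal_ne_top (hAm n))
    gcongr
    change 1 - ε n ≤ mixOutput (blockKernel κ n) (c n) (A n)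
    rw [mixOutput_apply]
    have hLn := hL.1 n
    calc 1 - ε n = (L n : ℝ≥0∞)⁻¹ * ∑ _l : Fin (L n), (1 - ε n) := by
          rw [Finset.sum_const, Finset.card_univ, Fintype.card_fin, nsmul_eq_mul, ← mul_assoc,
            ENNReal.inv_mul_cancel (by simp; omega) (by simp), one_mul]
      _ ≤ _ := by
          gcongr with l
          exact hword n hn l
  have hlim := ENNReal.Tendsto.sub (ENNReal.Tendsto.sub
    (tendsto_const_nhds (x := (1 : ℝ≥0∞)) (f := atTop)) hε0 (Or.inl (by simp))) hnull
    (Or.inl (by simp))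
  rw [tsub_zero, tsub_zero] at hlim
  exact absurd (le_of_tendsto_of_tendsto hlim hc hlow) (by simp)

end FiniteConverse

end EGammaResolvability

end

open EGammaResolvability in
theorem mainTheorem2 {U X : Type*} [MeasurableSpace U] [MeasurableSpace X]
    [MeasurableSpace.CountablyGenerated X]
    (κ : Kernel U X) [IsMarkovKernel κ] (π : Measure X) [IsProbabilityMeasure π]
    (E R : ℝ) (hE : 0 ≤ E) (L : ℕ → ℕ) (hL : EGammaResolvability.HasRate L R) :
    -- random codebooks drawn from a fixed input law: achievability and converse
    (∀ (Q : Measure U) [IsProbabilityMeasure Q],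
      (klDiv (κ ∘ₘ Q) π + (EGammaResolvability.mutualInfo Q κ - ENNReal.ofReal R)
          < ENNReal.ofReal E →
        Tendsto (fun n => EGammaResolvability.expectedEGamma Q κ π
          (EGammaResolvability.expThreshold E n) (L n) n) atTop (𝓝 0) ∧
        Tendsto (fun n => EGammaResolvability.expectedExcessInfo Q κ π
          (EGammaResolvability.expThreshold E n) (L n) n) atTop (𝓝 0)) ∧
      (ENNReal.ofReal E
          < klDiv (κ ∘ₘ Q) π + (EGammaResolvability.mutualInfo Q κ - ENNReal.ofReal R) →
        Tendsto (fun n => EGammaResolvability.expectedEGamma Q κ π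
          (EGammaResolvability.expThreshold E n) (L n) n) atTop (𝓝 1) ∧
        Tendsto (fun n => EGammaResolvability.expectedExcessInfo Q κ π
          (EGammaResolvability.expThreshold E n) (L n) n) atTop (𝓝 1))) ∧
    -- a rate above the single-letter rate is sufficient
    ((∃ Q₀ : ProbabilityMeasure U, klDiv (κ ∘ₘ (Q₀ : Measure U)) π < ENNReal.ofReal E ∧
        EGammaResolvability.mutualInfo (Q₀ : Measure U) κ ≠ ∞) →
      EGammaResolvability.singleLetterRate κ π E < (R : EReal) →
      ∃ c : (n : ℕ) → Fin (L n) → Fin n → U,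
        Tendsto (fun n => EGammaResolvability.eGamma (EGammaResolvability.expThreshold E n)
          (EGammaResolvability.outputLaw κ (c n)) (EGammaResolvability.iidLaw n π))
          atTop (𝓝 0)) ∧
    -- for finite alphabets it is necessary, whatever the codebooks are
    (Finite U → Finite X → DiscreteMeasurableSpace U → DiscreteMeasurableSpace X →
      ∀ c : (n : ℕ) → Fin (L n) → Fin n → U,
        Tendsto (fun n => EGammaResolvability.eGamma (EGammaResolvability.expThreshold E n)
          (EGammaResolvability.outputLaw κ (c n)) (EGammaResolvability.iidLaw n π))
          atTop (𝓝 0) →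
        EGammaResolvability.singleLetterRate κ π E ≤ (R : EReal)) := by
  have hR : 0 ≤ R := hL.nonneg
  refine ⟨fun Q hQ => ⟨fun h => ?_, fun h =>
    ⟨tendsto_expectedEGamma_one Q κ π hE hL h, tendsto_expectedExcessInfo_one Q κ π hE hL h⟩⟩,
    fun h₀ hr => exists_codebooks_of_singleLetterRate_lt κ π hL h₀ hr,
    fun hU _ _ _ c hc => ?_⟩
  -- Truncated subtraction in `ℝ≥0∞` is the positive part, so `h` yields both D < E and D + I < E +
  -- R.
  · have hD : klDiv (κ ∘ₘ Q) π < ENNReal.ofReal E := lt_of_le_of_lt le_self_add h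
    have hDI : klDiv (κ ∘ₘ Q) π + mutualInfo Q κ < ENNReal.ofReal (E + R) := by
      rw [ENNReal.ofReal_add hE hR]
      calc klDiv (κ ∘ₘ Q) π + mutualInfo Q κ
          ≤ klDiv (κ ∘ₘ Q) π + (mutualInfo Q κ - ENNReal.ofReal R) + ENNReal.ofReal R := by
            rw [add_assoc]
            gcongr
            exact le_tsub_add
        _ < _ := ENNReal.add_lt_add_right ENNReal.ofReal_ne_top h
    exact ⟨tendsto_expectedEGamma_zero Q κ π hL hD hDI,
      tendsto_expectedExcessInfo_zero Q κ π hL hD hDI⟩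
  · have := Fintype.ofFinite U
    exact singleLetterRate_le_of_tendsto κ π hE hL c hc
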